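/- Let $\theta\in\mathbb R$ and $\tau\in\mathbb C$ with $\Im\tau>0$. Let $A_\theta$ be the universal $C^*$-algebra generated by unitaries $U,V$ with $VU=e^{2\pi i\theta}UV$, with the action $\alpha_s(U^nV^m)=e^{i(s_1n+s_2m)}U^nV^m$ of $\mathbb R^2$, let $A_\theta^\infty$ be the $*$-algebra of those $a\in A_\theta$ for which $s\mapsto\alpha_s(a)$ is smooth, let $\delta_1,\delta_2$ be the derivations of $A_\theta^\infty$ with $\delta_1(U)=U,\ \delta_1(V)=0,\ \delta_2(U)=0,\ \delta_2(V)=V$ (that is, $\delta_j=-i\,\partial_{s_j}\alpha_s|_{s=0}$), and let $\varphi$ be the canonical trace, $\varphi(\sum a_{mn}U^mV^n)=a_{00}$. Put $g_\tau^{-1}=(g^{jk})=\begin{pmatrix}1&\Re\tau\\ \Re\tau&|\tau|^2\end{pmatrix}$. Let $\mathcal H^+=\mathcal H^{(0)}\oplus\mathcal H^{(2)}$ and $\mathcal H^-=\mathcal H^{(1)}$ be the completions of $A_\theta^\infty\oplus A_\theta^\infty$ for the inner products $$\langle (f,\omega),(f',\omega')\rangle=\tfrac1{\Im\tau}\varphi(f'^*f)+\Im(\tau)\,\varphi(\omega'^*\omega),\qquad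 \langle (a_1,a_2),(b_1,b_2)\rangle=\tfrac1{\Im\tau}\sum_{j,k}g^{jk}\varphi(b_k^*a_j),$$ and $\mathcal H=\mathcal H^+\oplus\mathcal H^-$. On smooth elements define $d:\mathcal H^+\to\mathcal H^-$ and $d^*:\mathcal H^-\to\mathcal H^+$ by $$d=\begin{pmatrix} i\delta_1 & i|\tau|^2\delta_2+i\Re(\tau)\delta_1\\ i\delta_2 & -i\Re(\tau)\delta_2-i\delta_1\end{pmatrix},\qquad d^*=\begin{pmatrix}-i\delta_1-i\Re(\tau)\delta_2 & -i\Re(\tau)\delta_1-i|\tau|^2\delta_2\\ -i\delta_2 & i\delta_1\end{pmatrix}.$$ A modular spectral triple $(\mathcal A,\mathcal K,D)$ with automorphism $\sigma$ consists of a unital involutive algebra $\mathcal A$ with a $*$-representation on a Hilbert space $\mathcal K$, an automorphism $\sigma$ of $\mathcal A$ with $\sigma(a^*)=\sigma^{-1}(a)^*$, and a self-adjoint operator $D$ on $\mathcal K$ with compact resolvent such that every $a\in\mathcal A$ preserves the domain of $D$ and $Da-\sigma(a)D$ is bounded. Its transpose is $(\mathcal A^{\rm op},\bar{\mathcal K},D^t)$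 on the dual Hilbert space $\bar{\mathcal K}$, with the transposed action and the automorphism $a^{\rm op}\mapsto(\sigma^{-1}(a))^{\rm op}$. Two triples over the same algebra are isomorphic if they have the same automorphism and a unitary of the Hilbert spaces intertwines the representations and the (unbounded) operators. Let $h=h^*\in A_\theta^\infty$ and $k=e^{h/2}$, and let $R_k$ denote right multiplication by $k$. Let $$\tilde D_h=\begin{pmatrix}0&R_k\circ d^*\\ d\circ R_k&0\end{pmatrix}\ \text{ with respect to } \mathcal H=\mathcal H^+\oplus\mathcal H^-,\qquad \bar D_h=\begin{pmatrix}0&kd\\ d^*k&0\end{pmatrix}\ \text{ with respect to } \mathcal H=\mathcal H^-\oplus\mathcal H^+,$$ where $k$ acts by left multiplication, and both operators are the closures of the operators so defined on smooth elements. Then: 1. $((A_\theta^\infty)^{\rm op},\mathcal H,\tilde D_h)$, with $(A_\theta^\infty)^{\rm op}$ acting by right multiplication, is a modular spectral triple for the automorphism $a^{\rm op}\mapsto(k^{-1}ak)^{\rm op}$. 2. $(A_\theta^\infty,\mathcal H,\bar D_h)$, with $A_\theta^\infty$ acting by left multiplication, is a modular spectral triple for the automorphism $a\mapsto kak^{-1}$,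 and, under the identification $((A_\theta^\infty)^{\rm op})^{\rm op}=A_\theta^\infty$, it is isomorphic to the transpose of the triple in 1. -/

import Mathlib

open scoped InnerProductSpace ContDiff

noncomputable section

namespace ModularTriple

section Dual

variable {H : Type*} [NormedAddCommGroup H] [InnerProductSpace ℂ H] [CompleteSpace H]

/-- The dual of a complex Hilbert space is a Hilbert space for the dual norm; its inner product is
the one that makes the conjugate-linear Riesz map `ξ ↦ ⟪ξ, ·⟫` anti-unitary. -/
instance dualInnerProductSpace : InnerProductSpace ℂ (StrongDual ℂ H) where
  inner ℓ m := ⟪(InnerProductSpace.toDual ℂ H).symm m, (InnerProductSpace.toDual ℂ H).symm ℓ⟫_ℂ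
  norm_sq_eq_re_inner ℓ := by
    rw [← (InnerProductSpace.toDual ℂ H).symm.norm_map ℓ]
    exact norm_sq_eq_re_inner _
  conj_inner_symm ℓ m := inner_conj_symm _ _
  add_left ℓ m n := by rw [map_add, inner_add_right]
  smul_left ℓ m r := by rw [map_smulₛₗ, inner_smul_right]

/-- The transpose `ℓ ↦ ℓ ∘ T` of a bounded operator. -/
def transposeCLM (T : H →L[ℂ] H) : StrongDual ℂ H →L[ℂ] StrongDual ℂ H :=
  ContinuousLinearMap.precomp ℂ T

lemma transposeCLM_apply (T : H →L[ℂ] H) (ℓ : StrongDual ℂ H) (x : H) :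
    transposeCLM T ℓ x = ℓ (T x) := rfl

/-- The transpose of an unbounded operator `D`: its graph consists of all pairs `(ℓ, m)` of
functionals with `m x = ℓ (D x)` on the domain of `D`. -/
def transposePMap (D : H →ₗ.[ℂ] H) : StrongDual ℂ H →ₗ.[ℂ] StrongDual ℂ H :=
  Submodule.toLinearPMap
    { carrier := {p | ∀ x : D.domain, p.2 x = p.1 (D x)}
      add_mem' := fun hp hq x => by simp [hp x, hq x]
      zero_mem' := fun x => by simp
      smul_mem' := fun c p hp x => by simp [hp x] }

lemma toDual_symm_transpose (T : H →L[ℂ] H) (ℓ : StrongDual ℂ H) :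
    (InnerProductSpace.toDual ℂ H).symm (transposeCLM T ℓ) =
      ContinuousLinearMap.adjoint T ((InnerProductSpace.toDual ℂ H).symm ℓ) := by
  refine ext_inner_right ℂ fun x => ?_
  rw [InnerProductSpace.toDual_symm_apply, ContinuousLinearMap.adjoint_inner_left,
    InnerProductSpace.toDual_symm_apply, transposeCLM_apply]

lemma transposeCLM_star (T : H →L[ℂ] H) : transposeCLM (star T) = star (transposeCLM T) := by
  refine (ContinuousLinearMap.eq_adjoint_iff _ _).2 fun ℓ m => ?_
  change ⟪(InnerProductSpace.toDual ℂ H).symm m,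
    (InnerProductSpace.toDual ℂ H).symm (transposeCLM (star T) ℓ)⟫_ℂ =
    ⟪(InnerProductSpace.toDual ℂ H).symm (transposeCLM T m),
      (InnerProductSpace.toDual ℂ H).symm ℓ⟫_ℂ
  rw [toDual_symm_transpose, toDual_symm_transpose, ContinuousLinearMap.star_eq_adjoint,
    ContinuousLinearMap.adjoint_adjoint, ContinuousLinearMap.adjoint_inner_left]

end Dual

/-- `R` is the bounded (everywhere defined) two-sided inverse of `D - z`. -/
def IsResolventAt {H : Type*} [NormedAddCommGroup H] [InnerProductSpace ℂ H]
    (D : H →ₗ.[ℂ] H) (z : ℂ) (R : H →L[ℂ] H) : Prop :=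
  (∀ x : D.domain, R (D x - z • (x : H)) = x) ∧
    ∀ y : H, ∃ hy : R y ∈ D.domain, D ⟨R y, hy⟩ - z • R y = y

/-- The resolvent set of `D` is nonempty and all resolvents of `D` are compact. -/
def HasCompactResolvent {H : Type*} [NormedAddCommGroup H] [InnerProductSpace ℂ H]
    (D : H →ₗ.[ℂ] H) : Prop :=
  (∃ z R, IsResolventAt D z R) ∧ ∀ z R, IsResolventAt D z R → IsCompactOperator R

end ModularTriple

/-- The data `(A, H, D)` and `σ` of a twisted triple: an involutive algebra `A` represented on a
Hilbert space `H`, an unbounded operator `D` on `H` and an automorphism `σ` of `A`. -/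
structure TwistedTriple (A H : Type*) [Ring A] [StarRing A] [Algebra ℂ A]
    [NormedAddCommGroup H] [InnerProductSpace ℂ H] [CompleteSpace H] where
  rep : A →⋆ₐ[ℂ] (H →L[ℂ] H)
  dirac : H →ₗ.[ℂ] H
  twist : A ≃ₐ[ℂ] A

namespace TwistedTriple

open ModularTriple

variable {A H : Type*} [Ring A] [StarRing A] [Algebra ℂ A]
    [NormedAddCommGroup H] [InnerProductSpace ℂ H] [CompleteSpace H]

/-- The data form a modular (twisted) spectral triple: `σ (a*) = (σ⁻¹ a)*`, the operator `D` is
self-adjoint with compact resolvent, and for every `a` the twisted commutator `D a - σ(a) D` is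
defined on the domain of `D` and bounded. -/
structure IsModularSpectralTriple (T : TwistedTriple A H) : Prop where
  twist_star : ∀ a, T.twist (star a) = star (T.twist.symm a)
  isSelfAdjoint : IsSelfAdjoint T.dirac
  compactResolvent : HasCompactResolvent T.dirac
  rep_mem_domain : ∀ a, ∀ x ∈ T.dirac.domain, T.rep a x ∈ T.dirac.domain
  bounded_twistedCommutator : ∀ a, ∃ C : ℝ, ∀ (x : T.dirac.domain)
    (hx : T.rep a x ∈ T.dirac.domain),
    ‖T.dirac ⟨T.rep a x, hx⟩ - T.rep (T.twist a) (T.dirac x)‖ ≤ C * ‖(x : H)‖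

open MulOpposite in
/-- The transposed triple over the opposite algebra, on the dual Hilbert space, with the transposed
action, the transposed operator and the automorphism `a^op ↦ (σ⁻¹ a)^op`. -/
def transpose (T : TwistedTriple A H) : TwistedTriple Aᵐᵒᵖ (StrongDual ℂ H) where
  rep :=
    { toFun := fun a => transposeCLM (T.rep a.unop)
      map_one' := by ext; simp [transposeCLM_apply]
      map_mul' := fun a b => by ext; simp [transposeCLM_apply]
      map_zero' := by ext; simp [transposeCLM_apply]
      map_add' := fun a b => by ext; simp [transposeCLM_apply]
      commutes' := fun r => by ext; simp [transposeCLM_apply, Algebra.algebraMap_eq_smul_one]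
      map_star' := fun a => by rw [unop_star, map_star, transposeCLM_star] }
  dirac := transposePMap T.dirac
  twist := AlgEquiv.op T.twist.symm

/-- Two triples are isomorphic over an identification `ι` of their algebras: `ι` intertwines the
automorphisms, and a unitary of the Hilbert spaces intertwines the actions and carries the one
unbounded operator (with its domain) to the other. -/
def IsIsomorphic {A' H' : Type*} [Ring A'] [StarRing A'] [Algebra ℂ A']
    [NormedAddCommGroup H'] [InnerProductSpace ℂ H'] [CompleteSpace H']
    (T : TwistedTriple A H) (T' : TwistedTriple A' H') (ι : A ≃⋆ₐ[ℂ] A') : Prop :=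
  (∀ a, ι (T.twist a) = T'.twist (ι a)) ∧
  ∃ W : H ≃ₗᵢ[ℂ] H', (∀ a x, W (T.rep a x) = T'.rep (ι a) (W x)) ∧
    ∀ x y, (x, y) ∈ T.dirac.graph ↔ (W x, W y) ∈ T'.dirac.graph

end TwistedTriple

/-- The canonical identification of an involutive algebra with its double opposite. -/
def opOpStar (A : Type*) [Ring A] [StarRing A] [Algebra ℂ A] : A ≃⋆ₐ[ℂ] Aᵐᵒᵖᵐᵒᵖ where
  toRingEquiv := RingEquiv.opOp A
  map_star' _ := rfl
  map_smul' _ _ := rfl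

namespace NCTorus

/-- The separable infinite-dimensional Hilbert space `ℓ²(ℤ²)`. -/
abbrev L2 : Type := lp (fun _ : ℤ × ℤ => ℂ) 2

/-- The phase `e^{2πiθ}`. -/
def phase (θ : ℝ) : Circle := Circle.exp (2 * Real.pi * θ)

/-- All pairs `(u, v)` of unitaries on a separable infinite-dimensional Hilbert space with
`v u = e^{2πiθ} u v`. -/
structure Rep (θ : ℝ) : Type where
  u : L2 →L[ℂ] L2
  v : L2 →L[ℂ] L2
  hu : u ∈ unitary (L2 →L[ℂ] L2)
  hv : v ∈ unitary (L2 →L[ℂ] L2)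
  comm : v * u = (phase θ : ℂ) • (u * v)

/-- The set of pairs carries the discrete topology: every function on it is continuous. -/
instance (θ : ℝ) : TopologicalSpace (Rep θ) := ⊥

instance (θ : ℝ) : DiscreteTopology (Rep θ) := ⟨rfl⟩

instance : Nontrivial L2 := ⟨⟨lp.single 2 (0, 0) 1, 0, fun h => by
  have := congrArg (fun x : L2 => x (0, 0)) h
  simp at this⟩⟩

/-- The C*-algebra of all bounded families of operators indexed by the pairs in `Rep θ`. -/
def Ambient (θ : ℝ) : Type := BoundedContinuousFunction (Rep θ) (L2 →L[ℂ] L2)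

instance (θ : ℝ) : CStarAlgebra (Ambient θ) :=
  inferInstanceAs (CStarAlgebra (BoundedContinuousFunction (Rep θ) (L2 →L[ℂ] L2)))

instance (θ : ℝ) : FunLike (Ambient θ) (Rep θ) (L2 →L[ℂ] L2) :=
  inferInstanceAs (FunLike (BoundedContinuousFunction (Rep θ) (L2 →L[ℂ] L2)) _ _)

lemma norm_le_one_of_unitary {u : L2 →L[ℂ] L2} (hu : u ∈ unitary (L2 →L[ℂ] L2)) : ‖u‖ ≤ 1 :=
  CStarRing.norm_of_mem_unitary hu |>.le

/-- The universal unitary `U`: the family of all first components. -/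
def genU (θ : ℝ) : Ambient θ :=
  BoundedContinuousFunction.ofNormedAddCommGroupDiscrete (fun p : Rep θ => p.u) 1
    (fun p => norm_le_one_of_unitary p.hu)

/-- The universal unitary `V`: the family of all second components. -/
def genV (θ : ℝ) : Ambient θ :=
  BoundedContinuousFunction.ofNormedAddCommGroupDiscrete (fun p : Rep θ => p.v) 1
    (fun p => norm_le_one_of_unitary p.hv)

/-- The noncommutative two torus `A_θ`, the universal C*-algebra generated by two unitaries `U`, `V`
with `V U = e^{2πiθ} U V`: the norm of a `*`-polynomial in `U`, `V` is the supremum of the norms of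
its values at all pairs of such unitaries on a separable Hilbert space. -/
def A (θ : ℝ) : StarSubalgebra ℂ (Ambient θ) :=
  (StarAlgebra.adjoin ℂ {genU θ, genV θ}).topologicalClosure

lemma circle_smul_mem_unitary (c : Circle) {u : L2 →L[ℂ] L2}
    (hu : u ∈ unitary (L2 →L[ℂ] L2)) : (c : ℂ) • u ∈ unitary (L2 →L[ℂ] L2) := by
  have hc : (starRingEnd ℂ) (c : ℂ) * c = 1 := by
    rw [← Complex.normSq_eq_conj_mul_self]; simp
  have hc' : (c : ℂ) * (starRingEnd ℂ) (c : ℂ) = 1 := by rw [mul_comm, hc]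
  rw [Unitary.mem_iff] at hu ⊢
  constructor
  · rw [star_smul, smul_mul_smul_comm, hu.1]; simp [hc]
  · rw [star_smul, smul_mul_smul_comm, hu.2]; simp [hc']

/-- `(u, v) ↦ (e^{is₁} u, e^{is₂} v)`. -/
def Rep.rotate {θ : ℝ} (s : ℝ × ℝ) (p : Rep θ) : Rep θ where
  u := (Circle.exp s.1 : ℂ) • p.u
  v := (Circle.exp s.2 : ℂ) • p.v
  hu := circle_smul_mem_unitary _ p.hu
  hv := circle_smul_mem_unitary _ p.hv
  comm := by
    rw [smul_mul_smul_comm, smul_mul_smul_comm, p.comm, smul_comm (phase θ : ℂ),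
      mul_comm (Circle.exp s.1 : ℂ)]

/-- The action of `ℝ²` with `α_s(U) = e^{is₁} U`, `α_s(V) = e^{is₂} V`. -/
def α {θ : ℝ} (s : ℝ × ℝ) : Ambient θ →⋆ₐ[ℂ] Ambient θ where
  toFun a := BoundedContinuousFunction.compContinuous a
    ⟨Rep.rotate s, continuous_of_discreteTopology⟩
  map_one' := rfl
  map_mul' _ _ := rfl
  map_zero' := rfl
  map_add' _ _ := rfl
  commutes' _ := rfl
  map_star' _ := rfl

@[simp] lemma α_apply {θ : ℝ} (s : ℝ × ℝ) (a : Ambient θ) (p : Rep θ) :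
    α s a p = a (p.rotate s) := rfl

lemma Ambient.ext {θ : ℝ} {a b : Ambient θ} (h : ∀ p, a p = b p) : a = b := DFunLike.ext _ _ h

lemma norm_α_le {θ : ℝ} (s : ℝ × ℝ) (a : Ambient θ) : ‖α s a‖ ≤ ‖a‖ :=
  (BoundedContinuousFunction.norm_le (f := α s a) (norm_nonneg a)).2 fun p =>
    BoundedContinuousFunction.norm_coe_le_norm (f := a) (p.rotate s)

/-- `α_s` as a continuous linear map. -/
def αCLM (θ : ℝ) (s : ℝ × ℝ) : Ambient θ →L[ℂ] Ambient θ :=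
  LinearMap.mkContinuous (α (θ := θ) s).toAlgHom.toLinearMap 1
    (fun a => by rw [one_mul]; exact norm_α_le s a)

lemma α_add {θ : ℝ} (s t : ℝ × ℝ) (a : Ambient θ) : α s (α t a) = α (s + t) a := by
  refine Ambient.ext fun p => ?_
  simp only [α_apply]
  congr 1
  simp [Rep.rotate, smul_smul, Circle.exp_add, mul_comm]

lemma α_zero {θ : ℝ} (a : Ambient θ) : α 0 a = a := by
  refine Ambient.ext fun p => ?_
  simp only [α_apply]
  congr 1
  simp [Rep.rotate]

lemma α_genU {θ : ℝ} (s : ℝ × ℝ) : α s (genU θ) = (Circle.exp s.1 : ℂ) • genU θ := rfl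
lemma α_genV {θ : ℝ} (s : ℝ × ℝ) : α s (genV θ) = (Circle.exp s.2 : ℂ) • genV θ := rfl

lemma α_mem {θ : ℝ} (s : ℝ × ℝ) {a : Ambient θ} (ha : a ∈ A θ) : α s a ∈ A θ := by
  have h1 : A θ ≤ (A θ).comap (α (θ := θ) s) := by
    apply StarSubalgebra.topologicalClosure_minimal
    · rw [StarAlgebra.adjoin_le_iff]
      have hsub := StarSubalgebra.le_topologicalClosure (StarAlgebra.adjoin ℂ {genU θ, genV θ})
      have hU : genU θ ∈ A θ := hsub (StarAlgebra.subset_adjoin ℂ _ (by simp))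
      have hV : genV θ ∈ A θ := hsub (StarAlgebra.subset_adjoin ℂ _ (by simp))
      rintro x (rfl | rfl)
      · exact (A θ).smul_mem hU _
      · exact (A θ).smul_mem hV _
    · exact (StarSubalgebra.isClosed_topologicalClosure _).preimage (αCLM θ s).continuous
  exact h1 ha

/-- The smooth subalgebra `A_θ^∞`: all `a ∈ A_θ` for which `s ↦ α_s(a)` is smooth. -/
def Smooth (θ : ℝ) : StarSubalgebra ℂ (Ambient θ) where
  carrier := {a | a ∈ A θ ∧ ContDiff ℝ ∞ fun s : ℝ × ℝ => α s a}
  mul_mem' ha hb := ⟨mul_mem ha.1 hb.1, by simpa only [map_mul] using ha.2.mul hb.2⟩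
  one_mem' := ⟨one_mem _, by simpa only [map_one] using contDiff_const⟩
  add_mem' ha hb := ⟨add_mem ha.1 hb.1, by simpa only [map_add] using ha.2.add hb.2⟩
  zero_mem' := ⟨zero_mem _, by simpa only [map_zero] using contDiff_const⟩
  algebraMap_mem' r := ⟨algebraMap_mem _ r, by
    simpa only [AlgHomClass.commutes] using contDiff_const⟩
  star_mem' ha := ⟨star_mem ha.1, by
    simp only [map_star]
    exact (starL' ℝ (A := Ambient θ)).contDiff.comp ha.2⟩

lemma contDiff_α {θ : ℝ} (a : Smooth θ) : ContDiff ℝ ∞ fun s : ℝ × ℝ => α s (a : Ambient θ) := a.2.2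

/-- `-i` times the derivative of `s ↦ α_s(a)` at `0` in the direction `e`. -/
def genVal {θ : ℝ} (e : ℝ × ℝ) (a : Ambient θ) : Ambient θ :=
  -Complex.I • fderiv ℝ (fun s : ℝ × ℝ => α s a) 0 e

lemma genVal_mem {θ : ℝ} (e : ℝ × ℝ) (a : Smooth θ) : genVal e (a : Ambient θ) ∈ Smooth θ := by
  have hd : Differentiable ℝ fun s : ℝ × ℝ => α s (a : Ambient θ) :=
    (contDiff_α a).differentiable (by simp)
  constructor
  · refine (A θ).smul_mem ?_ _
    have h1 : HasDerivAt (fun t : ℝ => α (t • e) (a : Ambient θ))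
        (fderiv ℝ (fun s : ℝ × ℝ => α s (a : Ambient θ)) 0 e) 0 := by
      have h2 := (hd ((0 : ℝ) • e)).hasFDerivAt.comp_hasDerivAt (0 : ℝ)
        ((hasDerivAt_id (0 : ℝ)).smul_const e)
      simp only [zero_smul, one_smul] at h2
      exact h2
    have h3 := h1.tendsto_slope_zero
    have hcl : IsClosed (A θ : Set (Ambient θ)) := StarSubalgebra.isClosed_topologicalClosure _
    refine hcl.mem_of_tendsto h3 (Filter.Eventually.of_forall fun t => ?_)
    have : ∀ x ∈ A θ, (t⁻¹ : ℝ) • x ∈ A θ := fun x hx => by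
      rw [← Complex.coe_smul]; exact (A θ).smul_mem hx _
    exact this _ (sub_mem (α_mem _ a.2.1) (α_mem _ a.2.1))
  · have key : (fun t : ℝ × ℝ => α t (genVal e (a : Ambient θ))) = fun t =>
        -Complex.I • fderiv ℝ (fun s : ℝ × ℝ => α s (a : Ambient θ)) t e := by
      funext t
      have h1 : HasFDerivAt (fun s : ℝ × ℝ => α (t + s) (a : Ambient θ))
          (fderiv ℝ (fun s : ℝ × ℝ => α s (a : Ambient θ)) t) 0 := by
        have := (hd (t + 0)).hasFDerivAt.comp (0 : ℝ × ℝ) ((hasFDerivAt_id (0 : ℝ × ℝ)).const_add t)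
        simp only [add_zero, ContinuousLinearMap.comp_id] at this
        exact this
      have h2 : HasFDerivAt (fun s : ℝ × ℝ => α (t + s) (a : Ambient θ))
          (((αCLM θ t).restrictScalars ℝ).comp
            (fderiv ℝ (fun s : ℝ × ℝ => α s (a : Ambient θ)) 0)) 0 := by
        have := ((αCLM θ t).restrictScalars ℝ).hasFDerivAt.comp (0 : ℝ × ℝ) (hd 0).hasFDerivAt
        refine this.congr_of_eventuallyEq (Filter.Eventually.of_forall fun s => ?_)
        exact (α_add t s _).symm
      have h3 := congrArg (fun L => L e) (h1.unique h2)
      have h4 : α t (genVal e (a : Ambient θ)) = -Complex.I •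
          α t (fderiv ℝ (fun s : ℝ × ℝ => α s (a : Ambient θ)) 0 e) :=
        map_smul (αCLM θ t) _ _
      rw [h4]
      congr 1
      exact h3.symm
    rw [key]
    exact (((contDiff_α a).fderiv_right (m := ∞) (by simp)).clm_apply contDiff_const).const_smul _

/-- The infinitesimal generator of the action in the direction `e`, normalized so that
`δ (1, 0) U = U` and `δ (0, 1) V = V`. -/
def δ {θ : ℝ} (e : ℝ × ℝ) : Smooth θ →ₗ[ℂ] Smooth θ where
  toFun a := ⟨genVal e (a : Ambient θ), genVal_mem e a⟩
  map_add' a b := by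
    apply Subtype.ext
    have ha := ((contDiff_α a).differentiable (by simp)) 0
    have hb := ((contDiff_α b).differentiable (by simp)) 0
    simp only [genVal, AddMemClass.coe_add, map_add]
    rw [fderiv_fun_add ha hb]
    exact smul_add _ _ _
  map_smul' c a := by
    apply Subtype.ext
    have ha := ((contDiff_α a).differentiable (by simp)) 0
    have h1 : (fun s : ℝ × ℝ => α s ((c • a : Smooth θ) : Ambient θ)) =
        fun s => c • α s (a : Ambient θ) := funext fun s => map_smul (α s) c (a : Ambient θ)
    change -Complex.I • fderiv ℝ (fun s : ℝ × ℝ => α s ((c • a : Smooth θ) : Ambient θ)) 0 e =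
      c • (-Complex.I • fderiv ℝ (fun s : ℝ × ℝ => α s (a : Ambient θ)) 0 e)
    rw [h1, fderiv_fun_const_smul ha c, smul_comm]
    rfl

/-- The derivation `δ₁`. -/
abbrev δ₁ {θ : ℝ} : Smooth θ →ₗ[ℂ] Smooth θ := δ (1, 0)

/-- The derivation `δ₂`. -/
abbrev δ₂ {θ : ℝ} : Smooth θ →ₗ[ℂ] Smooth θ := δ (0, 1)

lemma exp_mem_smooth {θ : ℝ} (a : Smooth θ) :
    NormedSpace.exp (a : Ambient θ) ∈ Smooth θ := by
  let _ : NormedAlgebra ℚ (Ambient θ) := NormedAlgebra.restrictScalars ℚ ℂ _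
  constructor
  · exact NormedSpace.exp_mem (R := ℂ) (StarSubalgebra.isClosed_topologicalClosure _) a.2.1
  · have : (fun s : ℝ × ℝ => α s (NormedSpace.exp (a : Ambient θ))) =
        fun s => NormedSpace.exp (α s (a : Ambient θ)) := by
      funext s
      exact NormedSpace.map_exp (α (θ := θ) s) (αCLM θ s).continuous _
    rw [this]
    have h : ContDiff ℝ ∞ (NormedSpace.exp : Ambient θ → Ambient θ) :=
      contDiff_iff_contDiffAt.2 fun x => (NormedSpace.exp_analytic (𝕂 := ℝ) x).contDiffAt
    exact h.comp (contDiff_α a)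

/-- `(c i * x (e i))_i`. -/
def shiftFun (c : ℤ × ℤ → Circle) (e : Equiv.Perm (ℤ × ℤ)) (x : L2) : L2 :=
  ⟨fun i => (c i : ℂ) * x (e i), by
    have h := (lp.memℓp x).summable (by norm_num)
    refine memℓp_gen ?_
    refine ((e.summable_iff (f := fun i => ‖x i‖ ^ (2 : ENNReal).toReal)).2 h).congr fun i => ?_
    rw [norm_mul, Circle.norm_coe, one_mul]
    rfl⟩

@[simp] lemma shiftFun_apply (c : ℤ × ℤ → Circle) (e : Equiv.Perm (ℤ × ℤ)) (x : L2) (i : ℤ × ℤ) :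
    shiftFun c e x i = (c i : ℂ) * x (e i) := rfl

/-- The weighted shift `x ↦ (c i * x (e i))_i` as a unitary of `ℓ²(ℤ²)`. -/
def wshift (c : ℤ × ℤ → Circle) (e : Equiv.Perm (ℤ × ℤ)) : L2 ≃ₗᵢ[ℂ] L2 where
  toFun := shiftFun c e
  invFun := shiftFun (fun i => (c (e.symm i))⁻¹) e.symm
  map_add' x y := by
    refine lp.ext (funext fun i => ?_)
    simp [mul_add]
  map_smul' r x := by
    refine lp.ext (funext fun i => ?_)
    simp [mul_left_comm]
  left_inv x := by
    refine lp.ext (funext fun i => ?_)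
    simp
  right_inv x := by
    refine lp.ext (funext fun i => ?_)
    simp
  norm_map' x := by
    have h2 : (0 : ℝ) < (2 : ENNReal).toReal := by norm_num
    rw [lp.norm_eq_tsum_rpow h2, lp.norm_eq_tsum_rpow h2]
    congr 1
    refine Eq.trans ?_ (e.tsum_eq (fun i => ‖x i‖ ^ (2 : ENNReal).toReal))
    refine tsum_congr fun i => ?_
    change ‖(c i : ℂ) * x (e i)‖ ^ _ = _
    rw [norm_mul, Circle.norm_coe, one_mul]

lemma wshift_apply (c : ℤ × ℤ → Circle) (e : Equiv.Perm (ℤ × ℤ)) (x : L2) (i : ℤ × ℤ) :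
    wshift c e x i = (c i : ℂ) * x (e i) := rfl

lemma wshift_symm_apply (c : ℤ × ℤ → Circle) (e : Equiv.Perm (ℤ × ℤ)) (x : L2) (i : ℤ × ℤ) :
    (wshift c e).symm x i = (((c (e.symm i))⁻¹ : Circle) : ℂ) * x (e.symm i) := rfl

/-- `(m, n) ↦ (m - 1, n)`. -/
def left : Equiv.Perm (ℤ × ℤ) := Equiv.prodCongr (Equiv.subRight 1) (Equiv.refl ℤ)

/-- `(m, n) ↦ (m, n - 1)`. -/
def down : Equiv.Perm (ℤ × ℤ) := Equiv.prodCongr (Equiv.refl ℤ) (Equiv.subRight 1)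

/-- Left multiplication by `U` on `ℓ²(ℤ²)`, where `e_{m,n}` stands for `U^m V^n`. -/
def regU : L2 ≃ₗᵢ[ℂ] L2 := wshift (fun _ => 1) left

/-- Left multiplication by `V` on `ℓ²(ℤ²)`: `V U^m V^n = e^{2πiθm} U^m V^{n+1}`. -/
def regV (θ : ℝ) : L2 ≃ₗᵢ[ℂ] L2 := wshift (fun i => phase θ ^ i.1) down

lemma mem_unitary_of_isometryEquiv (T : L2 ≃ₗᵢ[ℂ] L2) :
    (T : L2 →L[ℂ] L2) ∈ unitary (L2 →L[ℂ] L2) :=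
  (Unitary.linearIsometryEquiv.symm T).2

/-- The regular pair. -/
def reg (θ : ℝ) : Rep θ where
  u := regU
  v := regV θ
  hu := mem_unitary_of_isometryEquiv _
  hv := mem_unitary_of_isometryEquiv _
  comm := by
    refine ContinuousLinearMap.ext fun x => lp.ext (funext fun i => ?_)
    change wshift _ _ (wshift _ _ x) i = (phase θ : ℂ) * wshift _ _ (wshift _ _ x) i
    simp only [wshift_apply, left, down]
    obtain ⟨m, n⟩ := i
    simp only [Circle.coe_zpow, Circle.coe_one, one_mul, Equiv.prodCongr_apply, Prod.map,
      Equiv.subRight_apply, Equiv.refl_apply]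
    rw [← mul_assoc, ← zpow_one_add₀ (Circle.coe_ne_zero _), add_sub_cancel]

/-- The vector `e_{0,0}`. -/
def vacuum : L2 := lp.single 2 (0, 0) 1

/-- Evaluation at the regular pair. -/
def evalReg (θ : ℝ) : Ambient θ →⋆ₐ[ℂ] (L2 →L[ℂ] L2) where
  toFun a := a (reg θ)
  map_one' := rfl
  map_mul' _ _ := rfl
  map_zero' := rfl
  map_add' _ _ := rfl
  commutes' _ := rfl
  map_star' _ := rfl

lemma norm_evalReg_le {θ : ℝ} (a : Ambient θ) : ‖evalReg θ a‖ ≤ ‖a‖ :=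
  BoundedContinuousFunction.norm_coe_le_norm (f := a) (reg θ)

lemma continuous_evalReg (θ : ℝ) : Continuous (evalReg θ) :=
  continuous_eval_const (F := BoundedContinuousFunction (Rep θ) (L2 →L[ℂ] L2)) (reg θ)

/-- The canonical trace of `A_θ`, with `φ(∑ a_{mn} U^m V^n) = a_{00}`: the vector state of `e_{0,0}`
in the regular representation. -/
def φ {θ : ℝ} : Ambient θ →ₗ[ℂ] ℂ where
  toFun a := ⟪vacuum, evalReg θ a vacuum⟫_ℂ
  map_add' a b := by simp
  map_smul' c a := by simp

lemma φ_apply {θ : ℝ} (a : Ambient θ) : φ a = ⟪vacuum, evalReg θ a vacuum⟫_ℂ := rfl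

lemma φ_star_mul {θ : ℝ} (a b : Ambient θ) :
    φ (star a * b) = ⟪evalReg θ a vacuum, evalReg θ b vacuum⟫_ℂ := by
  have h : evalReg θ (star a * b) = star (evalReg θ a) * evalReg θ b := by
    rw [map_mul, map_star]
  rw [φ_apply, h]
  exact ContinuousLinearMap.adjoint_inner_right (evalReg θ a) _ _

lemma φ_star {θ : ℝ} (a : Ambient θ) : φ (star a) = (starRingEnd ℂ) (φ a) := by
  have h := φ_star_mul a 1
  rw [mul_one] at h
  rw [h, φ_apply, inner_conj_symm]
  simp

lemma continuous_φ {θ : ℝ} : Continuous (φ (θ := θ)) := by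
  have : Continuous fun a : Ambient θ => evalReg θ a vacuum :=
    (continuous_evalReg θ).clm_apply continuous_const
  exact continuous_const.inner this

lemma commute_of_mem {θ : ℝ} (T : L2 ≃ₗᵢ[ℂ] L2)
    (hU : (T : L2 →L[ℂ] L2) * (reg θ).u = (reg θ).u * T)
    (hV : (T : L2 →L[ℂ] L2) * (reg θ).v = (reg θ).v * T) {b : Ambient θ} (hb : b ∈ A θ) :
    (T : L2 →L[ℂ] L2) * evalReg θ b = evalReg θ b * T := by
  have hT := Unitary.mem_iff.1 (mem_unitary_of_isometryEquiv T)
  have hstar : ∀ S : L2 →L[ℂ] L2, (T : L2 →L[ℂ] L2) * S = S * T →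
      star (T : L2 →L[ℂ] L2) * S = S * star (T : L2 →L[ℂ] L2) := fun S h => by
    calc star (T : L2 →L[ℂ] L2) * S
        = star (T : L2 →L[ℂ] L2) * (S * T) * star (T : L2 →L[ℂ] L2) := by
          rw [mul_assoc, mul_assoc, hT.2, mul_one]
      _ = S * star (T : L2 →L[ℂ] L2) := by
          rw [← h, ← mul_assoc, hT.1, one_mul]
  have h1 : A θ ≤ (StarSubalgebra.centralizer ℂ {(T : L2 →L[ℂ] L2)}).comap (evalReg θ) := by
    apply StarSubalgebra.topologicalClosure_minimal
    · rw [StarAlgebra.adjoin_le_iff]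
      rintro x (rfl | rfl)
      · refine StarSubalgebra.mem_centralizer_iff ℂ |>.2 fun g hg => ?_
        rw [Set.mem_singleton_iff.1 hg]
        exact ⟨hU, hstar _ hU⟩
      · refine StarSubalgebra.mem_centralizer_iff ℂ |>.2 fun g hg => ?_
        rw [Set.mem_singleton_iff.1 hg]
        exact ⟨hV, hstar _ hV⟩
    · exact (Set.isClosed_centralizer _).preimage (continuous_evalReg θ)
  exact (StarSubalgebra.mem_centralizer_iff ℂ |>.1 (h1 hb) _ rfl).1

lemma φ_gen_comm {θ : ℝ} (S T : L2 ≃ₗᵢ[ℂ] L2) (g : Ambient θ) (hg : evalReg θ g = S)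
    (hU : (T : L2 →L[ℂ] L2) * (reg θ).u = (reg θ).u * T)
    (hV : (T : L2 →L[ℂ] L2) * (reg θ).v = (reg θ).v * T)
    (h1 : S vacuum = T vacuum) (h2 : S.symm vacuum = T.symm vacuum)
    {b : Ambient θ} (hb : b ∈ A θ) : φ (g * b) = φ (b * g) := by
  have hc := commute_of_mem T hU hV hb
  rw [φ_apply, φ_apply, map_mul, map_mul, hg]
  change ⟪vacuum, S (evalReg θ b vacuum)⟫_ℂ = ⟪vacuum, evalReg θ b (S vacuum)⟫_ℂ
  have hc' : T (evalReg θ b vacuum) = evalReg θ b (T vacuum) :=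
    congrArg (fun L : L2 →L[ℂ] L2 => L vacuum) hc
  rw [h1, ← hc', ← S.symm.inner_map_map, ← T.symm.inner_map_map vacuum (T _), h2]
  simp

lemma φ_genU_comm {θ : ℝ} {b : Ambient θ} (hb : b ∈ A θ) :
    φ (genU θ * b) = φ (b * genU θ) := by
  refine φ_gen_comm regU (wshift (fun i => phase θ ^ i.2) left) _ rfl ?_ ?_ ?_ ?_ hb
  · refine ContinuousLinearMap.ext fun x => lp.ext (funext fun i => ?_)
    change wshift _ _ (wshift _ _ x) i = wshift _ _ (wshift _ _ x) i
    simp [wshift_apply, left]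
  · refine ContinuousLinearMap.ext fun x => lp.ext (funext fun i => ?_)
    change wshift _ _ (wshift _ _ x) i = wshift _ _ (wshift _ _ x) i
    obtain ⟨m, n⟩ := i
    simp [wshift_apply, left, down, zpow_sub_one₀]
    ring
  · refine lp.ext (funext fun i => ?_)
    obtain ⟨m, n⟩ := i
    by_cases hn : n = 0
    · simp [regU, wshift_apply, left, vacuum, hn]
    · simp [regU, wshift_apply, left, vacuum, hn]
  · refine lp.ext (funext fun i => ?_)
    obtain ⟨m, n⟩ := i
    by_cases hn : n = 0
    · simp [regU, wshift_symm_apply, left, vacuum, hn]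
    · simp [regU, wshift_symm_apply, left, vacuum, hn]

lemma φ_genV_comm {θ : ℝ} {b : Ambient θ} (hb : b ∈ A θ) :
    φ (genV θ * b) = φ (b * genV θ) := by
  refine φ_gen_comm (regV θ) (wshift (fun _ => 1) down) _ rfl ?_ ?_ ?_ ?_ hb
  · refine ContinuousLinearMap.ext fun x => lp.ext (funext fun i => ?_)
    change wshift _ _ (wshift _ _ x) i = wshift _ _ (wshift _ _ x) i
    obtain ⟨m, n⟩ := i
    simp [wshift_apply, left, down]
  · refine ContinuousLinearMap.ext fun x => lp.ext (funext fun i => ?_)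
    change wshift _ _ (wshift _ _ x) i = wshift _ _ (wshift _ _ x) i
    simp [wshift_apply, down]
  · refine lp.ext (funext fun i => ?_)
    obtain ⟨m, n⟩ := i
    by_cases hn : m = 0
    · simp [regV, wshift_apply, down, vacuum, hn]
    · simp [regV, wshift_apply, down, vacuum, hn]
  · refine lp.ext (funext fun i => ?_)
    obtain ⟨m, n⟩ := i
    by_cases hn : m = 0
    · simp [regV, wshift_symm_apply, down, vacuum, hn]
    · simp [regV, wshift_symm_apply, down, vacuum, hn]

/-- `φ` is a trace on `A_θ`. -/
theorem φ_mul_comm {θ : ℝ} {a b : Ambient θ} (ha : a ∈ A θ) (hb : b ∈ A θ) :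
    φ (a * b) = φ (b * a) := by
  have hsub : StarAlgebra.adjoin ℂ {genU θ, genV θ} ≤ A θ :=
    StarSubalgebra.le_topologicalClosure _
  have h1 : ∀ x ∈ StarAlgebra.adjoin ℂ {genU θ, genV θ}, ∀ y ∈ A θ, φ (x * y) = φ (y * x) := by
    intro x hx
    induction hx using StarAlgebra.adjoin_induction with
    | mem x hx =>
      rcases hx with rfl | rfl
      · exact fun y hy => φ_genU_comm hy
      · exact fun y hy => φ_genV_comm hy
    | algebraMap r => exact fun y _ => by rw [Algebra.commutes]
    | add x y _ _ h1 h2 => exact fun z hz => by rw [add_mul, mul_add, map_add, map_add, h1 z hz, h2 z hz]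
    | mul x y hx hy h1 h2 =>
      exact fun z hz => by
        rw [mul_assoc, h1 _ (mul_mem (hsub hy) hz), mul_assoc, h2 _ (mul_mem hz (hsub hx)), mul_assoc]
    | star x _ h1 =>
      intro z hz
      have h2 := congrArg (starRingEnd ℂ) (h1 _ (star_mem hz))
      rw [← φ_star, ← φ_star, star_mul, star_mul, star_star] at h2
      exact h2.symm
  have hcl : IsClosed {x : Ambient θ | φ (x * b) = φ (b * x)} :=
    isClosed_eq (continuous_φ.comp (continuous_id.mul continuous_const))
      (continuous_φ.comp (continuous_const.mul continuous_id))
  exact closure_minimal (fun x hx => h1 x hx b hb) hcl ha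

/-- The trace on `A_θ^∞`. -/
def tr {θ : ℝ} : Smooth θ →ₗ[ℂ] ℂ := φ ∘ₗ (Smooth θ).subtype.toAlgHom.toLinearMap

/-- The vector of `ℓ²(ℤ²)` of Fourier coefficients of a smooth element. -/
def vec {θ : ℝ} : Smooth θ →ₗ[ℂ] L2 where
  toFun a := evalReg θ a vacuum
  map_add' a b := by simp
  map_smul' c a := by
    have : evalReg θ ((c • a : Smooth θ) : Ambient θ) = c • evalReg θ (a : Ambient θ) :=
      map_smul (evalReg θ) c (a : Ambient θ)
    rw [this]; rfl

lemma tr_star_mul {θ : ℝ} (a b : Smooth θ) : tr (star a * b) = ⟪vec a, vec b⟫_ℂ :=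
  φ_star_mul (a : Ambient θ) b

lemma tr_mul_comm {θ : ℝ} (a b : Smooth θ) : tr (a * b) = tr (b * a) := φ_mul_comm a.2.1 b.2.1

lemma norm_vec_mul_le {θ : ℝ} (a b : Smooth θ) : ‖vec (a * b)‖ ≤ ‖(a : Ambient θ)‖ * ‖vec b‖ := by
  have h : vec (a * b) = evalReg θ a (vec b) := by
    change evalReg θ ((a : Ambient θ) * b) vacuum = _
    rw [map_mul]; rfl
  rw [h]
  exact ((evalReg θ a).le_opNorm _).trans
    (mul_le_mul_of_nonneg_right (norm_evalReg_le _) (norm_nonneg _))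

lemma norm_vec_star {θ : ℝ} (a : Smooth θ) : ‖vec (star a)‖ = ‖vec a‖ := by
  have h : ⟪vec (star a), vec (star a)⟫_ℂ = ⟪vec a, vec a⟫_ℂ := by
    rw [← tr_star_mul, ← tr_star_mul, star_star, tr_mul_comm]
  rw [inner_self_eq_norm_sq_to_K, inner_self_eq_norm_sq_to_K] at h
  have h' : ‖vec (star a)‖ ^ 2 = ‖vec a‖ ^ 2 := by exact_mod_cast h
  exact (sq_eq_sq₀ (norm_nonneg _) (norm_nonneg _)).1 h'

lemma norm_vec_mul_le' {θ : ℝ} (a b : Smooth θ) : ‖vec (b * a)‖ ≤ ‖(a : Ambient θ)‖ * ‖vec b‖ := by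
  rw [← norm_vec_star, star_mul, ← norm_vec_star b]
  refine (norm_vec_mul_le _ _).trans_eq ?_
  congr 1
  exact norm_star (a : Ambient θ)

/-- The metric `g_τ⁻¹` on the dual of `ℝ²`. -/
def gInv (τ : UpperHalfPlane) : Matrix (Fin 2) (Fin 2) ℝ :=
  !![1, τ.re; τ.re, Complex.normSq τ]

/-- Smooth forms, written as `((f, ω), (a₁, a₂))` with a function `f`, a two form `ω` and a one form
`(a₁, a₂)`, that is, as pairs of an even and an odd form. -/
def PreForms (θ : ℝ) (τ : UpperHalfPlane) : Type := (Fin 2 → Smooth θ) × (Fin 2 → Smooth θ)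

section Forms

variable {θ : ℝ} {τ : UpperHalfPlane}

instance : AddCommGroup (PreForms θ τ) :=
  inferInstanceAs (AddCommGroup ((Fin 2 → Smooth θ) × (Fin 2 → Smooth θ)))

instance : Module ℂ (PreForms θ τ) :=
  inferInstanceAs (Module ℂ ((Fin 2 → Smooth θ) × (Fin 2 → Smooth θ)))

/-- The inner product on forms, linear in the second argument:
`(1/Im τ) φ(f* f') + (Im τ) φ(ω* ω') + (1/Im τ) ∑ g^{jk} φ(a_k* a'_j)`. -/
def preInner (x y : PreForms θ τ) : ℂ :=
  (1 / τ.im : ℝ) * tr (star (x.1 0) * y.1 0) + (τ.im : ℝ) * tr (star (x.1 1) * y.1 1) +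
    (1 / τ.im : ℝ) * ∑ j, ∑ k, (gInv τ j k : ℂ) * tr (star (x.2 k) * y.2 j)

lemma preInner_self (x : PreForms θ τ) :
    preInner x x = ((1 / τ.im * ‖vec (x.1 0)‖ ^ 2 + τ.im * ‖vec (x.1 1)‖ ^ 2 +
      1 / τ.im * (‖vec (x.2 0 + (τ.re : ℂ) • x.2 1)‖ ^ 2 + τ.im ^ 2 * ‖vec (x.2 1)‖ ^ 2) : ℝ) : ℂ) := by
  simp only [preInner, tr_star_mul, gInv, Fin.sum_univ_two, Matrix.of_apply, Matrix.cons_val',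
    Matrix.cons_val_zero, Matrix.cons_val_one, Matrix.cons_val_fin_one]
  have h : ((‖vec (x.2 0 + (τ.re : ℂ) • x.2 1)‖ ^ 2 : ℝ) : ℂ) =
      ⟪vec (x.2 0), vec (x.2 0)⟫_ℂ + τ.re * ⟪vec (x.2 0), vec (x.2 1)⟫_ℂ +
      τ.re * ⟪vec (x.2 1), vec (x.2 0)⟫_ℂ + τ.re ^ 2 * ⟪vec (x.2 1), vec (x.2 1)⟫_ℂ := by
    have := inner_self_eq_norm_sq_to_K (𝕜 := ℂ) (vec (x.2 0 + (τ.re : ℂ) • x.2 1))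
    push_cast
    refine this.symm.trans ?_
    rw [map_add, map_smul]
    simp only [inner_add_left, inner_add_right, inner_smul_left, inner_smul_right,
      Complex.conj_ofReal]
    ring
  have hs : ∀ a : Smooth θ, ((‖vec a‖ : ℝ) : ℂ) ^ 2 = ⟪vec a, vec a⟫_ℂ := fun a =>
    (inner_self_eq_norm_sq_to_K (𝕜 := ℂ) (vec a)).symm
  have hn : Complex.normSq τ = τ.re ^ 2 + τ.im ^ 2 := by
    rw [Complex.normSq_apply]; simp [sq]
  rw [hn]
  push_cast at h ⊢
  rw [h, hs, hs, hs]
  ring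

/-- `preInner` is a positive semidefinite Hermitian form. -/
abbrev preCore (θ : ℝ) (τ : UpperHalfPlane) : PreInnerProductSpace.Core ℂ (PreForms θ τ) where
  inner := preInner
  conj_inner_symm x y := by
    simp only [preInner, tr_star_mul, map_add, map_mul, Complex.conj_ofReal, inner_conj_symm,
      map_sum]
    congr 2
    rw [Finset.sum_comm]
    refine Finset.sum_congr rfl fun j _ => Finset.sum_congr rfl fun k _ => ?_
    congr 2
    fin_cases j <;> fin_cases k <;> rfl
  re_inner_nonneg x := by
    rw [preInner_self, RCLike.re_eq_complex_re, Complex.ofReal_re]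
    have := τ.im_pos
    positivity
  add_left x y z := by
    have h1 : ∀ i, (x + y).1 i = x.1 i + y.1 i := fun _ => rfl
    have h2 : ∀ i, (x + y).2 i = x.2 i + y.2 i := fun _ => rfl
    simp only [preInner, h1, h2, star_add, add_mul, map_add, mul_add, Finset.sum_add_distrib]
    ring
  smul_left x y r := by
    have h1 : ∀ i, (r • x).1 i = r • x.1 i := fun _ => rfl
    have h2 : ∀ i, (r • x).2 i = r • x.2 i := fun _ => rfl
    simp only [preInner, h1, h2, tr_star_mul, map_smul, inner_smul_left, mul_add, Finset.mul_sum,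
      mul_left_comm]

instance : SeminormedAddCommGroup (PreForms θ τ) :=
  InnerProductSpace.Core.toSeminormedAddCommGroup (c := preCore θ τ)

instance : InnerProductSpace ℂ (PreForms θ τ) := InnerProductSpace.ofCore (preCore θ τ)

lemma inner_def (x y : PreForms θ τ) : ⟪x, y⟫_ℂ = preInner x y := rfl

/-- The Hilbert space `H = H^+ ⊕ H^-`, with `H^+ = H^(0) ⊕ H^(2)` (functions and two forms) and
`H^- = H^(1)` (one forms): the completion of the smooth forms. -/
abbrev Forms (θ : ℝ) (τ : UpperHalfPlane) : Type := UniformSpace.Completion (PreForms θ τ)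

lemma norm_sq_def (x : PreForms θ τ) :
    ‖x‖ ^ 2 = 1 / τ.im * ‖vec (x.1 0)‖ ^ 2 + τ.im * ‖vec (x.1 1)‖ ^ 2 +
      1 / τ.im * (‖vec (x.2 0 + (τ.re : ℂ) • x.2 1)‖ ^ 2 + τ.im ^ 2 * ‖vec (x.2 1)‖ ^ 2) := by
  have h := inner_self_eq_norm_sq_to_K (𝕜 := ℂ) x
  rw [inner_def, preInner_self] at h
  exact (Complex.ofReal_injective (h.trans (Complex.ofReal_pow _ 2).symm)).symm

/-- `T` applied to each of two entries. -/
def entrywise (T : Smooth θ →ₗ[ℂ] Smooth θ) : (Fin 2 → Smooth θ) →ₗ[ℂ] (Fin 2 → Smooth θ) :=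
  LinearMap.pi fun i => T ∘ₗ LinearMap.proj i

/-- A bounded operator on functions, applied to all four components of a form. -/
def boundedMap (T : Smooth θ →ₗ[ℂ] Smooth θ) (C : ℝ) (hC : 0 ≤ C)
    (hT : ∀ a, ‖vec (T a)‖ ≤ C * ‖vec a‖) : PreForms θ τ →L[ℂ] PreForms θ τ :=
  LinearMap.mkContinuous
    (LinearMap.prodMap (entrywise T) (entrywise T) : PreForms θ τ →ₗ[ℂ] PreForms θ τ) C
    (fun x => by
      have := τ.im_pos
      rw [← sq_le_sq₀ (norm_nonneg _) (by positivity), mul_pow, norm_sq_def, norm_sq_def]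
      have hT' : ∀ a, ‖vec (T a)‖ ^ 2 ≤ C ^ 2 * ‖vec a‖ ^ 2 := fun a => by
        rw [← mul_pow]; exact pow_le_pow_left₀ (norm_nonneg _) (hT a) 2
      change 1 / τ.im * ‖vec (T (x.1 0))‖ ^ 2 + τ.im * ‖vec (T (x.1 1))‖ ^ 2 +
        1 / τ.im * (‖vec (T (x.2 0) + (τ.re : ℂ) • T (x.2 1))‖ ^ 2 +
          τ.im ^ 2 * ‖vec (T (x.2 1))‖ ^ 2) ≤ _
      rw [← map_smul T, ← map_add T]
      calc _ ≤ 1 / τ.im * (C ^ 2 * ‖vec (x.1 0)‖ ^ 2) + τ.im * (C ^ 2 * ‖vec (x.1 1)‖ ^ 2) +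
            1 / τ.im * (C ^ 2 * ‖vec (x.2 0 + (τ.re : ℂ) • x.2 1)‖ ^ 2 +
              τ.im ^ 2 * (C ^ 2 * ‖vec (x.2 1)‖ ^ 2)) := by
            gcongr <;> exact hT' _
        _ = _ := by ring)

/-- Left multiplication by `a` on each component. -/
def leftMul (a : Smooth θ) : PreForms θ τ →L[ℂ] PreForms θ τ :=
  boundedMap (LinearMap.mulLeft ℂ a) ‖(a : Ambient θ)‖ (norm_nonneg _) (norm_vec_mul_le a)

/-- Right multiplication by `a` on each component. -/
def rightMul (a : Smooth θ) : PreForms θ τ →L[ℂ] PreForms θ τ :=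
  boundedMap (LinearMap.mulRight ℂ a) ‖(a : Ambient θ)‖ (norm_nonneg _) (norm_vec_mul_le' a)

lemma PreForms.ext {x y : PreForms θ τ} (h1 : ∀ i, x.1 i = y.1 i) (h2 : ∀ i, x.2 i = y.2 i) :
    x = y := Prod.ext (funext h1) (funext h2)

lemma leftMul_fst (a : Smooth θ) (x : PreForms θ τ) (i : Fin 2) :
    (leftMul a x).1 i = a * x.1 i := rfl

lemma leftMul_snd (a : Smooth θ) (x : PreForms θ τ) (i : Fin 2) :
    (leftMul a x).2 i = a * x.2 i := rfl

lemma rightMul_fst (a : Smooth θ) (x : PreForms θ τ) (i : Fin 2) :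
    (rightMul a x).1 i = x.1 i * a := rfl

lemma rightMul_snd (a : Smooth θ) (x : PreForms θ τ) (i : Fin 2) :
    (rightMul a x).2 i = x.2 i * a := rfl

lemma completion_ext {S T : Forms θ τ →L[ℂ] Forms θ τ} (h : ∀ x : PreForms θ τ, S x = T x) :
    S = T := by
  ext x
  induction x using UniformSpace.Completion.induction_on with
  | hp => apply isClosed_eq <;> fun_prop
  | ih x => exact h x

/-- Left multiplication as a `*`-representation of `A_θ^∞` on the Hilbert space of forms. -/
def leftRep (θ : ℝ) (τ : UpperHalfPlane) : Smooth θ →⋆ₐ[ℂ] (Forms θ τ →L[ℂ] Forms θ τ) where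
  toFun a := (leftMul a).completion
  map_one' := completion_ext fun x => by
    have h : leftMul (τ := τ) (1 : Smooth θ) x = x :=
      PreForms.ext (fun _ => one_mul _) (fun _ => one_mul _)
    exact (ContinuousLinearMap.completion_apply_coe _ _).trans (congrArg _ h)
  map_mul' a b := completion_ext fun x => by
    have h : leftMul (τ := τ) (a * b) x = leftMul a (leftMul b x) :=
      PreForms.ext (fun _ => mul_assoc _ _ _) (fun _ => mul_assoc _ _ _)
    change _ = (leftMul a).completion ((leftMul b).completion (x : Forms θ τ))
    rw [ContinuousLinearMap.completion_apply_coe,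
      ContinuousLinearMap.completion_apply_coe, ContinuousLinearMap.completion_apply_coe, ← h]
  map_zero' := completion_ext fun x => by
    have h : leftMul (τ := τ) (0 : Smooth θ) x = 0 :=
      PreForms.ext (fun _ => zero_mul _) (fun _ => zero_mul _)
    exact (ContinuousLinearMap.completion_apply_coe _ _).trans (congrArg _ h)
  map_add' a b := completion_ext fun x => by
    have h : leftMul (τ := τ) (a + b) x = leftMul a x + leftMul b x :=
      PreForms.ext (fun _ => add_mul _ _ _) (fun _ => add_mul _ _ _)
    rw [add_apply, ContinuousLinearMap.completion_apply_coe,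
      ContinuousLinearMap.completion_apply_coe, ContinuousLinearMap.completion_apply_coe,
      ← UniformSpace.Completion.coe_add, ← h]
  commutes' r := completion_ext fun x => by
    have h : leftMul (τ := τ) (r • (1 : Smooth θ)) x = r • x :=
      PreForms.ext (fun _ => smul_one_mul _ _) (fun _ => smul_one_mul _ _)
    rw [Algebra.algebraMap_eq_smul_one, Algebra.algebraMap_eq_smul_one, smul_apply,
      ContinuousLinearMap.completion_apply_coe, one_apply_eq_self,
      ← UniformSpace.Completion.coe_smul, ← h]
  map_star' a := by
    refine (ContinuousLinearMap.eq_adjoint_iff _ _).2 fun x y => ?_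
    induction x, y using UniformSpace.Completion.induction_on₂ with
    | hp => apply isClosed_eq <;> fun_prop
    | ih x y =>
      rw [ContinuousLinearMap.completion_apply_coe, ContinuousLinearMap.completion_apply_coe,
        UniformSpace.Completion.inner_coe, UniformSpace.Completion.inner_coe, inner_def, inner_def]
      simp only [preInner, leftMul_fst, leftMul_snd, star_mul, star_star, mul_assoc]

/-- Right multiplication as a `*`-representation of the opposite algebra of `A_θ^∞` on the Hilbert
space of forms. -/
def rightRep (θ : ℝ) (τ : UpperHalfPlane) :
    (Smooth θ)ᵐᵒᵖ →⋆ₐ[ℂ] (Forms θ τ →L[ℂ] Forms θ τ) where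
  toFun a := (rightMul a.unop).completion
  map_one' := completion_ext fun x => by
    have h : rightMul (τ := τ) (1 : Smooth θ) x = x :=
      PreForms.ext (fun _ => mul_one _) (fun _ => mul_one _)
    exact (ContinuousLinearMap.completion_apply_coe _ _).trans (congrArg _ h)
  map_mul' a b := completion_ext fun x => by
    have h : rightMul (τ := τ) (b.unop * a.unop) x = rightMul a.unop (rightMul b.unop x) :=
      PreForms.ext (fun _ => (mul_assoc _ _ _).symm) (fun _ => (mul_assoc _ _ _).symm)
    change _ = (rightMul a.unop).completion ((rightMul b.unop).completion (x : Forms θ τ))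
    rw [ContinuousLinearMap.completion_apply_coe,
      ContinuousLinearMap.completion_apply_coe, ContinuousLinearMap.completion_apply_coe, ← h]
    rfl
  map_zero' := completion_ext fun x => by
    have h : rightMul (τ := τ) (0 : Smooth θ) x = 0 :=
      PreForms.ext (fun _ => mul_zero _) (fun _ => mul_zero _)
    exact (ContinuousLinearMap.completion_apply_coe _ _).trans (congrArg _ h)
  map_add' a b := completion_ext fun x => by
    have h : rightMul (τ := τ) (a.unop + b.unop) x = rightMul a.unop x + rightMul b.unop x :=
      PreForms.ext (fun _ => mul_add _ _ _) (fun _ => mul_add _ _ _)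
    rw [add_apply, ContinuousLinearMap.completion_apply_coe,
      ContinuousLinearMap.completion_apply_coe, ContinuousLinearMap.completion_apply_coe,
      ← UniformSpace.Completion.coe_add, ← h]
    rfl
  commutes' r := completion_ext fun x => by
    have h : rightMul (τ := τ) (r • (1 : Smooth θ)) x = r • x :=
      PreForms.ext (fun _ => mul_smul_one _ _) (fun _ => mul_smul_one _ _)
    rw [Algebra.algebraMap_eq_smul_one, Algebra.algebraMap_eq_smul_one, smul_apply,
      ContinuousLinearMap.completion_apply_coe, one_apply_eq_self,
      ← UniformSpace.Completion.coe_smul, ← h]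
    rfl
  map_star' a := by
    have key : ∀ b c : Smooth θ, tr (star (b * star a.unop) * c) = tr (star b * (c * a.unop)) :=
      fun b c => by rw [star_mul, star_star, mul_assoc, tr_mul_comm, mul_assoc]
    refine (ContinuousLinearMap.eq_adjoint_iff _ _).2 fun x y => ?_
    induction x, y using UniformSpace.Completion.induction_on₂ with
    | hp => apply isClosed_eq <;> fun_prop
    | ih x y =>
      rw [ContinuousLinearMap.completion_apply_coe, ContinuousLinearMap.completion_apply_coe,
        UniformSpace.Completion.inner_coe, UniformSpace.Completion.inner_coe, inner_def, inner_def]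
      simp only [preInner, rightMul_fst, rightMul_snd, MulOpposite.unop_star, key]

/-- The operator given by a `2 × 2` matrix of operators on `A_θ^∞`. -/
def ofBlocks (M : Matrix (Fin 2) (Fin 2) (Module.End ℂ (Smooth θ))) :
    (Fin 2 → Smooth θ) →ₗ[ℂ] (Fin 2 → Smooth θ) :=
  LinearMap.pi fun i => ∑ j, M i j ∘ₗ LinearMap.proj j

open Complex in
/-- The operator `d = d₀ + d₁*` from `H^+` to `H^-` on smooth elements. -/
def d (θ : ℝ) (τ : UpperHalfPlane) : (Fin 2 → Smooth θ) →ₗ[ℂ] (Fin 2 → Smooth θ) :=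
  ofBlocks
    !![I • δ₁, (I * normSq τ) • δ₂ + (I * τ.re) • δ₁;
       I • δ₂, -(I * τ.re) • δ₂ - I • δ₁]

open Complex in
/-- The operator `d* = d₀* + d₁` from `H^-` to `H^+` on smooth elements. -/
def dStar (θ : ℝ) (τ : UpperHalfPlane) : (Fin 2 → Smooth θ) →ₗ[ℂ] (Fin 2 → Smooth θ) :=
  ofBlocks
    !![-I • δ₁ - (I * τ.re) • δ₂, -(I * τ.re) • δ₁ - (I * normSq τ) • δ₂;
       -I • δ₂, I • δ₁]

/-- The Weyl factor `k = e^{h/2}`, an invertible element of `A_θ^∞`. -/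
def weyl (h : Smooth θ) : (Smooth θ)ˣ where
  val := ⟨NormedSpace.exp (((1 / 2 : ℂ) • h : Smooth θ) : Ambient θ), exp_mem_smooth _⟩
  inv := ⟨NormedSpace.exp ((-((1 / 2 : ℂ) • h) : Smooth θ) : Ambient θ), exp_mem_smooth _⟩
  val_inv := by
    let _ : NormedAlgebra ℚ (Ambient θ) := NormedAlgebra.restrictScalars ℚ ℂ _
    apply Subtype.ext
    change NormedSpace.exp (((1 / 2 : ℂ) • h : Smooth θ) : Ambient θ) *
      NormedSpace.exp (-(((1 / 2 : ℂ) • h : Smooth θ) : Ambient θ)) = 1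
    rw [← NormedSpace.exp_add_of_commute (Commute.refl _).neg_right, add_neg_cancel,
      NormedSpace.exp_zero]
  inv_val := by
    let _ : NormedAlgebra ℚ (Ambient θ) := NormedAlgebra.restrictScalars ℚ ℂ _
    apply Subtype.ext
    change NormedSpace.exp (-(((1 / 2 : ℂ) • h : Smooth θ) : Ambient θ)) *
      NormedSpace.exp (((1 / 2 : ℂ) • h : Smooth θ) : Ambient θ) = 1
    rw [← NormedSpace.exp_add_of_commute (Commute.refl _).neg_left, neg_add_cancel,
      NormedSpace.exp_zero]

/-- On smooth forms, the operator with matrix `(0, R_k ∘ d*; d ∘ R_k, 0)` with respect to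
`H = H^+ ⊕ H^-`, where `R_k` is right multiplication by `k`. -/
def DTildeCore (h : Smooth θ) : PreForms θ τ →ₗ[ℂ] PreForms θ τ where
  toFun x := (entrywise (LinearMap.mulRight ℂ (weyl h : Smooth θ)) (dStar θ τ x.2),
    d θ τ (entrywise (LinearMap.mulRight ℂ (weyl h : Smooth θ)) x.1))
  map_add' x y := by
    have h1 : (x + y).1 = x.1 + y.1 := rfl
    have h2 : (x + y).2 = x.2 + y.2 := rfl
    rw [h1, h2]; simp only [map_add]; rfl
  map_smul' c x := by
    have h1 : (c • x).1 = c • x.1 := rfl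
    have h2 : (c • x).2 = c • x.2 := rfl
    rw [h1, h2]; simp only [map_smul]; rfl

/-- On smooth forms, the operator with matrix `(0, k d; d* k, 0)`, where `k` acts by left
multiplication. As `d` maps `H^+` to `H^-`, this matrix is written with respect to `H = H^- ⊕ H^+`. -/
def DBarCore (h : Smooth θ) : PreForms θ τ →ₗ[ℂ] PreForms θ τ where
  toFun x := (dStar θ τ (entrywise (LinearMap.mulLeft ℂ (weyl h : Smooth θ)) x.2),
    entrywise (LinearMap.mulLeft ℂ (weyl h : Smooth θ)) (d θ τ x.1))
  map_add' x y := by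
    have h1 : (x + y).1 = x.1 + y.1 := rfl
    have h2 : (x + y).2 = x.2 + y.2 := rfl
    rw [h1, h2]; simp only [map_add]; rfl
  map_smul' c x := by
    have h1 : (c • x).1 = c • x.1 := rfl
    have h2 : (c • x).2 = c • x.2 := rfl
    rw [h1, h2]; simp only [map_smul]; rfl

/-- The closed operator with core the smooth forms: its graph is the closure of the graph of `T`. -/
def closedOp (T : PreForms θ τ →ₗ[ℂ] PreForms θ τ) : Forms θ τ →ₗ.[ℂ] Forms θ τ :=
  (LinearMap.range (LinearMap.prod
    (UniformSpace.Completion.toComplₗᵢ (𝕜 := ℂ) (E := PreForms θ τ)).toLinearMap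
    ((UniformSpace.Completion.toComplₗᵢ (𝕜 := ℂ) (E := PreForms θ τ)).toLinearMap ∘ₗ T))
    ).topologicalClosure.toLinearPMap

/-- The inner automorphism `a ↦ k a k⁻¹`. -/
def conj {A : Type*} [Ring A] [Algebra ℂ A] (k : Aˣ) : A ≃ₐ[ℂ] A where
  toFun a := k * a * ↑k⁻¹
  invFun a := ↑k⁻¹ * a * k
  left_inv a := by simp [mul_assoc]
  right_inv a := by simp [mul_assoc]
  map_mul' a b := by simp [mul_assoc]
  map_add' a b := by simp [mul_add, add_mul]
  commutes' r := by rw [← Algebra.commutes, mul_assoc, Units.mul_inv, mul_one]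

/-- The triple over the opposite algebra of `A_θ^∞` acting by right multiplication, with the operator
`D̃_h = (0, R_k ∘ d*; d ∘ R_k, 0)` and the automorphism `a^op ↦ (k⁻¹ a k)^op`. -/
def tildeTriple (θ : ℝ) (τ : UpperHalfPlane) (h : Smooth θ) :
    TwistedTriple (Smooth θ)ᵐᵒᵖ (Forms θ τ) where
  rep := rightRep θ τ
  dirac := closedOp (DTildeCore h)
  twist := AlgEquiv.op (conj (weyl h)⁻¹)

/-- The perturbed triple over `A_θ^∞` acting by left multiplication, with the operator
`D̄_h = (0, k d; d* k, 0)` and the automorphism `a ↦ k a k⁻¹`. -/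
def barTriple (θ : ℝ) (τ : UpperHalfPlane) (h : Smooth θ) :
    TwistedTriple (Smooth θ) (Forms θ τ) where
  rep := leftRep θ τ
  dirac := closedOp (DBarCore h)
  twist := conj (weyl h)

end Forms

end NCTorus

end

/-!
Write `D = d + d^*` as `c(1, 0) δ₁ + c(0, 1) δ₂`, where the Clifford multiplications `c(ξ)` are
self-adjoint, commute with `δ₁` and `δ₂`, and satisfy `c(ξ)² = |ξ₁ + ξ₂ τ|²`. Hence `D²` is diagonal
with eigenvalues `|m + n τ|² → ∞` on the forms whose only component in a suitable orthonormal frame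
is `U^m V^n`. As these make up an orthonormal basis, `D` is essentially self-adjoint with compact
resolvent.

Both perturbed operators have the form `S D S` with `S` bounded, invertible and self-adjoint: `S`
multiplies by `k` on one parity and by `1` on the other. The closure of `S D S` is `S D̄ S`,
which inherits self-adjointness and the compactness of the resolvent from `D̄`. If `N, N'`
multiply by `a` and by its twist, each on one parity, then `S a = N S` and `σ(a) S = S N'`, so
the twisted commutator of `S D S` with `a` is `S (D N - N' D) S`. It is bounded because, by the
Leibniz rule, only derivatives of `a` and of its twist survive in `D N - N' D`.

The conjugate-linear isometry which exchanges the parities and takes adjoints in the orthonormal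
frame commutes with `D` and turns left into right multiplication. Composed with the Riesz map, it is
the isomorphism with the transposed triple.
-/

noncomputable section

open Filter Topology
open UniformSpace (Completion)

namespace ModularTriple

section Relation

variable {H : Type*} [NormedAddCommGroup H] [InnerProductSpace ℂ H]
  {G : Submodule ℂ (H × H)} {p q : H × H}

lemma mem_adjoint_iff_inner_eq : p ∈ G.adjoint ↔ ∀ q ∈ G, ⟪q.2, p.1⟫_ℂ = ⟪q.1, p.2⟫_ℂ := by
  simp only [Submodule.mem_adjoint_iff, Prod.forall, sub_eq_zero]

lemma isClosed_adjoint : IsClosed (G.adjoint : Set (H × H)) := by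
  have h : (G.adjoint : Set (H × H)) = ⋂ q ∈ G, {p | ⟪q.2, p.1⟫_ℂ = ⟪q.1, p.2⟫_ℂ} := by
    ext p
    simp only [SetLike.mem_coe, mem_adjoint_iff_inner_eq, Set.mem_iInter, Set.mem_ofPred_eq]
  rw [h]
  exact isClosed_biInter fun q _ => isClosed_eq (by fun_prop) (by fun_prop)

lemma inner_snd_eq_of_le_adjoint (hG : G ≤ G.adjoint) (hp : p ∈ G) (hq : q ∈ G) :
    ⟪p.2, q.1⟫_ℂ = ⟪p.1, q.2⟫_ℂ :=
  mem_adjoint_iff_inner_eq.1 (hG hq) p hp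

lemma norm_sub_I_smul_sq {x y : H} (h : ⟪y, x⟫_ℂ = ⟪x, y⟫_ℂ) :
    ‖y - Complex.I • x‖ ^ 2 = ‖y‖ ^ 2 + ‖x‖ ^ 2 := by
  have h_im : (⟪y, x⟫_ℂ).im = 0 := Complex.conj_eq_iff_im.1 (by rw [inner_conj_symm, h])
  rw [@norm_sub_sq ℂ, inner_smul_right, norm_smul]
  simp [h_im]

lemma norm_le_norm_sub_I_smul {x y : H} (h : ⟪y, x⟫_ℂ = ⟪x, y⟫_ℂ) :
    ‖((x, y) : H × H)‖ ≤ ‖y - Complex.I • x‖ := by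
  have h_sq := norm_sub_I_smul_sq h
  exact max_le (abs_le_of_sq_le_sq' (by linarith [sq_nonneg ‖y‖]) (norm_nonneg _)).2
    (abs_le_of_sq_le_sq' (by linarith [sq_nonneg ‖x‖]) (norm_nonneg _)).2

lemma exists_equiv_sub_I_smul [CompleteSpace H] (h_closed : IsClosed (G : Set (H × H)))
    (hG : G ≤ G.adjoint)
    (h_dense : ∀ z : H, (∀ p ∈ G, ⟪p.2 - Complex.I • p.1, z⟫_ℂ = 0) → z = 0) :
    ∃ e : G ≃L[ℂ] H, ∀ p : G, e p = (p : H × H).2 - Complex.I • (p : H × H).1 := by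
  have : CompleteSpace G := h_closed.completeSpace_coe
  let f : G →L[ℂ] H :=
    (ContinuousLinearMap.snd ℂ H H - Complex.I • ContinuousLinearMap.fst ℂ H H) ∘L G.subtypeL
  have h_bij : Function.Bijective f := by
    rw [ContinuousLinearMap.bijective_iff_dense_range_and_antilipschitz]
    constructor
    · rw [Submodule.topologicalClosure_eq_top_iff, Submodule.eq_bot_iff]
      exact fun z hz => h_dense z fun p hp =>
        (Submodule.mem_orthogonal _ _).1 hz _ ⟨⟨p, hp⟩, rfl⟩
    · refine ⟨1, f.antilipschitz_of_bound fun p => ?_⟩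
      rw [NNReal.coe_one, one_mul]
      exact norm_le_norm_sub_I_smul (inner_snd_eq_of_le_adjoint hG p.2 p.2)
  exact ⟨ContinuousLinearEquiv.ofBijective f (LinearMap.ker_eq_bot.2 h_bij.1)
    (LinearMap.range_eq_top.2 h_bij.2), fun p => rfl⟩

lemma eq_zero_of_orthogonal_sub_I_smul (hG : G.adjoint = G) {z : H}
    (hz : ∀ p ∈ G, ⟪p.2 - Complex.I • p.1, z⟫_ℂ = 0) : z = 0 := by
  have h_mem : (z, -Complex.I • z) ∈ G := by
    rw [← hG, mem_adjoint_iff_inner_eq]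
    intro q hq
    have h := hz q hq
    rwa [inner_sub_left, inner_smul_left, sub_eq_zero, Complex.conj_I, ← inner_smul_right] at h
  have h := hz _ h_mem
  rw [neg_smul, inner_sub_left, inner_neg_left, inner_smul_left, Complex.conj_I] at h
  have h_two : (2 * Complex.I) * ⟪z, z⟫_ℂ = 0 := by linear_combination h
  exact inner_self_eq_zero.1 ((mul_eq_zero.1 h_two).resolve_left (by simp))

lemma adjoint_eq_of_dense_range [CompleteSpace H] (h_closed : IsClosed (G : Set (H × H)))
    (hG : G ≤ G.adjoint)
    (h_sub : ∀ z : H, (∀ p ∈ G, ⟪p.2 - Complex.I • p.1, z⟫_ℂ = 0) → z = 0)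
    (h_add : ∀ z : H, (∀ p ∈ G, ⟪p.2 + Complex.I • p.1, z⟫_ℂ = 0) → z = 0) :
    G.adjoint = G := by
  refine le_antisymm (fun p hp => ?_) hG
  obtain ⟨e, he⟩ := exists_equiv_sub_I_smul h_closed hG h_sub
  obtain ⟨q, hq⟩ := e.surjective (p.2 - Complex.I • p.1)
  rw [he] at hq
  have h_diff : p - q ∈ G.adjoint := sub_mem hp (hG q.2)
  have h_snd : (p - q).2 = Complex.I • (p - q).1 := by
    rw [Prod.snd_sub, Prod.fst_sub, smul_sub]
    have h := sub_eq_sub_iff_sub_eq_sub.1 hq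
    rw [← neg_inj, neg_sub, neg_sub]
    exact h
  have h_fst : (p - q).1 = 0 := by
    refine h_add _ fun r hr => ?_
    have h := mem_adjoint_iff_inner_eq.1 h_diff r hr
    rw [h_snd, inner_smul_right] at h
    rw [inner_add_left, inner_smul_left, h, Complex.conj_I]
    ring
  have h_zero : p - q = 0 := Prod.ext h_fst (by rw [h_snd, h_fst, smul_zero, Prod.snd_zero])
  rw [sub_eq_zero.1 h_zero]
  exact q.2

section ToLinearPMap

variable (h_dense : Dense (G.map (LinearMap.fst ℂ H H) : Set H))

include h_dense in
lemma graph_toLinearPMap (hG : G ≤ G.adjoint) : G.toLinearPMap.graph = G := by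
  refine Submodule.toLinearPMap_graph_eq _ fun p hp hp_fst => ?_
  refine h_dense.eq_zero_of_inner_right ℂ ?_
  rintro _ ⟨q, hq, rfl⟩
  have h := inner_snd_eq_of_le_adjoint hG hq hp
  rw [hp_fst, inner_zero_right] at h
  exact h.symm

variable [CompleteSpace H] (hG : G.adjoint = G)

include h_dense hG

lemma isSelfAdjoint_toLinearPMap : IsSelfAdjoint G.toLinearPMap := by
  rw [LinearPMap.isSelfAdjoint_def]
  apply LinearPMap.eq_of_eq_graph
  rw [LinearPMap.adjoint_graph_eq_graph_adjoint (T := G.toLinearPMap) h_dense,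
    graph_toLinearPMap h_dense hG.ge, hG]

lemma exists_isResolventAt_I : ∃ R : H →L[ℂ] H, IsResolventAt G.toLinearPMap Complex.I R := by
  have h_graph := graph_toLinearPMap h_dense hG.ge
  obtain ⟨e, he⟩ := exists_equiv_sub_I_smul (hG ▸ isClosed_adjoint) hG.ge
    fun z hz => eq_zero_of_orthogonal_sub_I_smul hG hz
  refine ⟨ContinuousLinearMap.fst ℂ H H ∘L G.subtypeL ∘L e.symm.toContinuousLinearMap,
    fun x => ?_, fun y => ?_⟩
  · have hx : e ⟨(x, G.toLinearPMap x), h_graph.le (LinearPMap.mem_graph _ x)⟩ =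
      G.toLinearPMap x - Complex.I • (x : H) := he _
    simp [← hx]
  · obtain ⟨x, hx_fst, hx_snd⟩ := (LinearPMap.mem_graph_iff _).1 (h_graph.ge (e.symm y).2)
    have h_dom : (e.symm y : H × H).1 ∈ G.toLinearPMap.domain := hx_fst ▸ x.2
    have hx : x = ⟨(e.symm y : H × H).1, h_dom⟩ := Subtype.ext hx_fst
    refine ⟨h_dom, ?_⟩
    change G.toLinearPMap ⟨(e.symm y : H × H).1, h_dom⟩ - Complex.I • (e.symm y : H × H).1 = y
    rw [← hx, hx_snd, ← he, e.apply_symm_apply]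

omit [CompleteSpace H] in
lemma isCompactOperator_of_isResolventAt
    (h_compact : IsCompactOperator fun p : G => (p : H × H).1) {z : ℂ} {R : H →L[ℂ] H}
    (hR : IsResolventAt G.toLinearPMap z R) : IsCompactOperator R := by
  have h_mem : ∀ y, (R y, y + z • R y) ∈ G := fun y => by
    obtain ⟨h_dom, hy⟩ := hR.2 y
    rw [← sub_eq_iff_eq_add.1 hy]
    exact (graph_toLinearPMap h_dense hG.ge).le (LinearPMap.mem_graph _ ⟨R y, h_dom⟩)
  exact h_compact.comp_clm
    ((R.prod (ContinuousLinearMap.id ℂ H + z • R)).codRestrict G h_mem)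

lemma hasCompactResolvent_toLinearPMap
    (h_compact : IsCompactOperator fun p : G => (p : H × H).1) :
    HasCompactResolvent G.toLinearPMap :=
  ⟨⟨Complex.I, exists_isResolventAt_I h_dense hG⟩,
    fun _ _ hR => isCompactOperator_of_isResolventAt h_dense hG h_compact hR⟩

lemma mem_graph_transposePMap_iff {ℓ : StrongDual ℂ H × StrongDual ℂ H} :
    ℓ ∈ (transposePMap G.toLinearPMap).graph ↔
      ((InnerProductSpace.toDual ℂ H).symm ℓ.1, (InnerProductSpace.toDual ℂ H).symm ℓ.2) ∈ G := by
  have h_graph := graph_toLinearPMap h_dense hG.ge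
  have h_riesz : ∀ q : H × H, ℓ.2 q.1 = ℓ.1 q.2 ↔
      ⟪q.2, (InnerProductSpace.toDual ℂ H).symm ℓ.1⟫_ℂ =
        ⟪q.1, (InnerProductSpace.toDual ℂ H).symm ℓ.2⟫_ℂ := fun q => by
    rw [← inner_conj_symm, ← inner_conj_symm q.1, InnerProductSpace.toDual_symm_apply,
      InnerProductSpace.toDual_symm_apply, (starRingEnd ℂ).injective.eq_iff, eq_comm]
  have h_domain : ∀ m : StrongDual ℂ H × StrongDual ℂ H,
      (∀ x : G.toLinearPMap.domain, m.2 x = m.1 (G.toLinearPMap x)) ↔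
        ∀ q ∈ G, m.2 q.1 = m.1 q.2 := fun m => by
    refine ⟨fun h q hq => ?_, fun h x => h _ (h_graph.le (LinearPMap.mem_graph _ x))⟩
    obtain ⟨x, hx_fst, hx_snd⟩ := (LinearPMap.mem_graph_iff _).1 (h_graph.ge hq)
    rw [← hx_fst, ← hx_snd, h x]
  rw [transposePMap, Submodule.toLinearPMap_graph_eq]
  · conv_rhs => rw [← hG, mem_adjoint_iff_inner_eq]
    exact (h_domain ℓ).trans (forall₂_congr fun q _ => h_riesz q)
  · intro m hm hm_fst
    refine DFunLike.coe_injective (Continuous.ext_on h_dense m.2.continuous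
      (0 : StrongDual ℂ H).continuous ?_)
    rintro _ ⟨q, hq, rfl⟩
    have h := (h_domain m).1 hm q hq
    rwa [hm_fst] at h

end ToLinearPMap

/-- The relation `S G S` for a bounded invertible operator `S`. -/
def sandwich (S : H ≃L[ℂ] H) (G : Submodule ℂ (H × H)) : Submodule ℂ (H × H) :=
  G.comap (LinearMap.prodMap S.toLinearMap S.symm.toLinearMap)

lemma mem_sandwich {S : H ≃L[ℂ] H} : p ∈ sandwich S G ↔ (S p.1, S.symm p.2) ∈ G := Iff.rfl

lemma adjoint_sandwich (S : H ≃L[ℂ] H) (hS : ∀ x y, ⟪S x, y⟫_ℂ = ⟪x, S y⟫_ℂ)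
    (hG : G.adjoint = G) : (sandwich S G).adjoint = sandwich S G := by
  have hS_symm : ∀ x y, ⟪S.symm x, y⟫_ℂ = ⟪x, S.symm y⟫_ℂ := fun x y => by
    conv_lhs => rw [← S.apply_symm_apply y, ← hS, S.apply_symm_apply]
  ext p
  rw [mem_sandwich, mem_adjoint_iff_inner_eq]
  conv_rhs => rw [← hG, mem_adjoint_iff_inner_eq]
  constructor
  · intro h q hq
    have hq' := h (S.symm q.1, S q.2) (by simpa [mem_sandwich] using hq)
    rwa [hS, hS_symm] at hq'
  · intro h q hq
    have hq' := h _ (mem_sandwich.1 hq)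
    rwa [← hS, ← hS_symm, S.apply_symm_apply, S.symm_apply_apply] at hq'

lemma isCompactOperator_fst_sandwich (S : H ≃L[ℂ] H)
    (h_compact : IsCompactOperator fun p : G => (p : H × H).1) :
    IsCompactOperator fun p : sandwich S G => (p : H × H).1 := by
  let F : sandwich S G →L[ℂ] G :=
    ((S.toContinuousLinearMap.prodMap S.symm.toContinuousLinearMap) ∘L
      (sandwich S G).subtypeL).codRestrict G fun p => mem_sandwich.1 p.2
  have h_comp : S.symm ∘ (fun p : G => (p : H × H).1) ∘ F = fun p : sandwich S G => (p : H × H).1 :=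
    funext fun p => S.symm_apply_apply _
  exact h_comp ▸ (h_compact.comp_clm F).clm_comp S.symm.toContinuousLinearMap

end Relation

section HilbertBasis

variable {ι H : Type*} [NormedAddCommGroup H] [InnerProductSpace ℂ H] (B : HilbertBasis ι ℂ H)

/-- The orthogonal projection onto the span of the basis vectors with index in `F`, as a finite sum
of rank-one operators. -/
def truncate (F : Finset ι) : H →L[ℂ] H := ∑ i ∈ F, (innerSL ℂ (B i)).smulRight (B i)

lemma truncate_apply (F : Finset ι) (x : H) : truncate B F x = ∑ i ∈ F, ⟪B i, x⟫_ℂ • B i := by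
  simp [truncate]

lemma isCompactOperator_truncate (F : Finset ι) : IsCompactOperator (truncate B F) :=
  Submodule.sum_mem (compactOperator (RingHom.id ℂ) H H) fun i _ =>
    (isCompactOperator_of_locallyCompactSpace_dom (innerSL ℂ (B i))).clm_comp
      ((ContinuousLinearMap.id ℂ ℂ).smulRight (B i))

lemma inner_sub_truncate [DecidableEq ι] (F : Finset ι) (x : H) (i : ι) :
    ⟪B i, x - truncate B F x⟫_ℂ = if i ∈ F then 0 else ⟪B i, x⟫_ℂ := by
  simp only [truncate_apply, inner_sub_right, inner_sum, inner_smul_right,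
    orthonormal_iff_ite.1 B.orthonormal, mul_ite, mul_one, mul_zero, Finset.sum_ite_eq]
  split_ifs <;> simp

lemma isCompactOperator_of_truncate {V : Type*} [SeminormedAddCommGroup V] [NormedSpace ℂ V]
    [CompleteSpace H] {f : V →L[ℂ] H}
    (hf : ∀ ε > 0, ∃ F : Finset ι, ∀ v, ‖f v - truncate B F (f v)‖ ≤ ε * ‖v‖) :
    IsCompactOperator f := by
  have h_closure : f ∈ closure {g : V →L[ℂ] H | IsCompactOperator g} := by
    refine Metric.mem_closure_iff.2 fun ε hε => ?_
    obtain ⟨F, hF⟩ := hf (ε / 2) (half_pos hε)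
    refine ⟨truncate B F ∘L f, (isCompactOperator_truncate B F).comp_clm f, ?_⟩
    rw [dist_eq_norm]
    exact (ContinuousLinearMap.opNorm_le_bound _ (half_pos hε).le hF).trans_lt (half_lt_self hε)
  exact isClosed_setOfPred_isCompactOperator.closure_subset h_closure

lemma hasSum_norm_inner_sq (x : H) : HasSum (fun i => ‖⟪B i, x⟫_ℂ‖ ^ 2) (‖x‖ ^ 2) := by
  convert (B.hasSum_inner_mul_inner x x).mapL Complex.reCLM using 1
  · funext i
    rw [← inner_conj_symm x, Complex.conj_mul']
    simp [← Complex.ofReal_pow]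
  · exact norm_sq_eq_re_inner (𝕜 := ℂ) x

lemma mul_norm_sub_truncate_sq_le {μ : ι → ℝ} (hμ : ∀ i, 0 ≤ μ i) {x : H} {s M : ℝ}
    (hs : HasSum (fun i => μ i * ‖⟪B i, x⟫_ℂ‖ ^ 2) s) {F : Finset ι} (hF : ∀ i ∉ F, M ≤ μ i) :
    M * ‖x - truncate B F x‖ ^ 2 ≤ s := by
  classical
  refine hasSum_le (fun i => ?_) ((hasSum_norm_inner_sq B _).mul_left M) hs
  rw [inner_sub_truncate]
  split_ifs with hi
  · simpa using mul_nonneg (hμ i) (sq_nonneg _)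
  · exact mul_le_mul_of_nonneg_right (hF i hi) (sq_nonneg _)

end HilbertBasis

section ClosedGraph

variable {E F : Type*} [SeminormedAddCommGroup E] [InnerProductSpace ℂ E]
  [SeminormedAddCommGroup F] [InnerProductSpace ℂ F]

/-- The closure, in the completion, of the graph of an operator on a pre-Hilbert space. -/
def closedGraph (T : E →ₗ[ℂ] E) : Submodule ℂ (Completion E × Completion E) :=
  (LinearMap.range (LinearMap.prod
    (Completion.toComplₗᵢ (𝕜 := ℂ) (E := E)).toLinearMap
    ((Completion.toComplₗᵢ (𝕜 := ℂ) (E := E)).toLinearMap ∘ₗ T))).topologicalClosure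

variable {T : E →ₗ[ℂ] E} {p : Completion E × Completion E}

lemma isClosed_closedGraph : IsClosed (closedGraph T : Set (Completion E × Completion E)) :=
  Submodule.isClosed_topologicalClosure _

lemma coe_mem_closedGraph (T : E →ₗ[ℂ] E) (x : E) :
    ((x : Completion E), (T x : Completion E)) ∈ closedGraph T :=
  Submodule.le_topologicalClosure _ ⟨x, rfl⟩

lemma closedGraph_induction {P : Completion E × Completion E → Prop} (hP : IsClosed {p | P p})
    (h : ∀ x : E, P ((x : Completion E), (T x : Completion E))) (hp : p ∈ closedGraph T) : P p := by
  refine closure_minimal (t := {p | P p}) ?_ hP hp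
  rintro _ ⟨x, rfl⟩
  exact h x

lemma dense_map_fst_closedGraph (T : E →ₗ[ℂ] E) :
    Dense ((closedGraph T).map (LinearMap.fst ℂ _ _) : Set (Completion E)) := by
  refine Completion.denseRange_coe.mono ?_
  rintro _ ⟨x, rfl⟩
  exact ⟨_, coe_mem_closedGraph T x, rfl⟩

lemma mem_closedGraph_iff_of_intertwining {T' : F →ₗ[ℂ] F} {f₁ f₂ : E → F}
    (e₁ e₂ : Completion E ≃ₜ Completion F) (h₁ : ∀ x : E, e₁ x = f₁ x) (h₂ : ∀ x : E, e₂ x = f₂ x)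
    (hf₁ : Function.Surjective f₁) (hT : ∀ x, T' (f₁ x) = f₂ (T x)) :
    p ∈ closedGraph T ↔ (e₁ p.1, e₂ p.2) ∈ closedGraph T' := by
  let e := e₁.prodCongr e₂
  constructor <;> intro hp
  · refine closedGraph_induction (P := fun p => e p ∈ closedGraph T')
      (isClosed_closedGraph.preimage e.continuous) (fun x => ?_) hp
    change (e₁ x, e₂ (T x)) ∈ _
    rw [h₁, h₂, ← hT]
    exact coe_mem_closedGraph T' _
  · suffices h : e.symm (e p) ∈ closedGraph T by rwa [e.symm_apply_apply] at h
    refine closedGraph_induction (P := fun q => e.symm q ∈ closedGraph T)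
      (isClosed_closedGraph.preimage e.symm.continuous) (fun y => ?_) hp
    obtain ⟨x, rfl⟩ := hf₁ y
    have h_image : e ((x : Completion E), (T x : Completion E)) = (↑(f₁ x), ↑(T' (f₁ x))) := by
      rw [hT, ← h₁, ← h₂]
      rfl
    rw [← h_image, e.symm_apply_apply]
    exact coe_mem_closedGraph T x

section Symmetric

variable (hT : ∀ x y, ⟪T x, y⟫_ℂ = ⟪x, T y⟫_ℂ)

include hT

lemma closedGraph_le_adjoint : closedGraph T ≤ (closedGraph T).adjoint := by
  refine fun p hp => mem_adjoint_iff_inner_eq.2 fun q hq => ?_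
  refine closedGraph_induction (P := fun q => ⟪q.2, p.1⟫_ℂ = ⟪q.1, p.2⟫_ℂ)
    (isClosed_eq (by fun_prop) (by fun_prop)) (fun x => ?_) hq
  refine closedGraph_induction
    (P := fun p => ⟪(T x : Completion E), p.1⟫_ℂ = ⟪(x : Completion E), p.2⟫_ℂ)
    (isClosed_eq (by fun_prop) (by fun_prop)) (fun y => ?_) hp
  simp only [Completion.inner_coe, hT]

variable {ι : Type*} {b : ι → E} {μ : ι → ℝ} {B : HilbertBasis ι ℂ (Completion E)}
  (hB : ∀ i, B i = b i) (hb : ∀ i, T (T (b i)) = (μ i : ℂ) • b i) (hμ : ∀ i, 0 ≤ μ i)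

include hB hb

omit hT in
include hμ in
lemma eq_zero_of_orthogonal_add_smul {c : ℂ} (hc : c * c = -1) {z : Completion E}
    (hz : ∀ p ∈ closedGraph T, ⟪p.2 + c • p.1, z⟫_ℂ = 0) : z = 0 := by
  have h_factor : ∀ i, T (T (b i) - c • b i) + c • (T (b i) - c • b i) =
      ((μ i + 1 : ℝ) : ℂ) • b i := fun i => by
    rw [map_sub, map_smul, hb, smul_sub, smul_smul, hc]
    push_cast
    module
  have h_coeff : ∀ i, ⟪B i, z⟫_ℂ = 0 := fun i => by
    have h := hz _ (coe_mem_closedGraph T (T (b i) - c • b i))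
    rw [← Completion.coe_smul, ← Completion.coe_add, h_factor, Completion.coe_smul,
      inner_smul_left, ← hB, Complex.conj_ofReal] at h
    exact (mul_eq_zero.1 h).resolve_left
      (Complex.ofReal_ne_zero.2 (add_pos_of_nonneg_of_pos (hμ i) one_pos).ne')
  refine B.repr.map_eq_zero_iff.1 (lp.ext (funext fun i => ?_))
  rw [B.repr_apply_apply, h_coeff, lp.coeFn_zero, Pi.zero_apply]

include hμ in
lemma adjoint_closedGraph : (closedGraph T).adjoint = closedGraph T := by
  refine adjoint_eq_of_dense_range isClosed_closedGraph (closedGraph_le_adjoint hT)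
    (fun z hz => ?_) (fun z hz => eq_zero_of_orthogonal_add_smul hB hb hμ Complex.I_mul_I hz)
  refine eq_zero_of_orthogonal_add_smul hB hb hμ (c := -Complex.I) (by simp) fun p hp => ?_
  rw [neg_smul, ← sub_eq_add_neg]
  exact hz p hp

lemma hasSum_eigenvalue_mul_norm_inner_sq (v : E) :
    HasSum (fun i => μ i * ‖⟪B i, (v : Completion E)⟫_ℂ‖ ^ 2) (‖T v‖ ^ 2) := by
  convert (B.hasSum_inner_mul_inner (v : Completion E) (T (T v) : Completion E)).mapL
    Complex.reCLM using 1
  · funext i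
    rw [hB, Completion.inner_coe (b i) (T (T v)), ← hT, ← hT, hb, inner_smul_left,
      Complex.conj_ofReal, mul_left_comm, Completion.inner_coe, Completion.inner_coe,
      ← inner_conj_symm v, Complex.conj_mul']
    simp [← Complex.ofReal_pow]
  · rw [Completion.inner_coe, ← hT]
    exact norm_sq_eq_re_inner (𝕜 := ℂ) _

include hμ in
lemma isCompactOperator_fst_closedGraph (hμ_tendsto : Tendsto μ cofinite atTop) :
    IsCompactOperator fun p : closedGraph T => (p : Completion E × Completion E).1 := by
  refine isCompactOperator_of_truncate B
    (f := ContinuousLinearMap.fst ℂ _ _ ∘L (closedGraph T).subtypeL) fun ε hε => ?_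
  have h_finite : {i | ¬ (1 / ε) ^ 2 ≤ μ i}.Finite :=
    hμ_tendsto.eventually (eventually_ge_atTop _)
  refine ⟨h_finite.toFinset, fun p => ?_⟩
  have h_tail : (1 / ε) ^ 2 * ‖p.1.1 - truncate B h_finite.toFinset p.1.1‖ ^ 2 ≤ ‖p.1.2‖ ^ 2 := by
    refine closedGraph_induction (P := fun p => (1 / ε) ^ 2 *
        ‖p.1 - truncate B h_finite.toFinset p.1‖ ^ 2 ≤ ‖p.2‖ ^ 2)
      (isClosed_le (by fun_prop) (by fun_prop)) (fun v => ?_) p.2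
    rw [Completion.norm_coe]
    exact mul_norm_sub_truncate_sq_le B hμ (hasSum_eigenvalue_mul_norm_inner_sq hT hB hb v)
      fun i hi => by simpa using hi
  rw [← mul_pow] at h_tail
  have h_bound := (abs_le_of_sq_le_sq' h_tail (norm_nonneg _)).2.trans (norm_snd_le p.1)
  rwa [one_div_mul_eq_div, div_le_iff₀' hε] at h_bound

end Symmetric

section Sandwich

/-- The extension of a bounded invertible operator to the completion. -/
def completionEquiv (S : E ≃L[ℂ] E) : Completion E ≃L[ℂ] Completion E :=
  ContinuousLinearEquiv.equivOfInverse (S : E →L[ℂ] E).completion (S.symm : E →L[ℂ] E).completion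
    (fun x => by
      induction x using Completion.induction_on with
      | hp => apply isClosed_eq <;> fun_prop
      | ih x => simp)
    (fun x => by
      induction x using Completion.induction_on with
      | hp => apply isClosed_eq <;> fun_prop
      | ih x => simp)

variable (S : E ≃L[ℂ] E)

lemma completionEquiv_coe (x : E) : completionEquiv S x = S x :=
  ContinuousLinearMap.completion_apply_coe _ _

lemma completionEquiv_symm_coe (x : E) : (completionEquiv S).symm x = S.symm x :=
  ContinuousLinearMap.completion_apply_coe _ _

lemma inner_completionEquiv_left (hS : ∀ x y, ⟪S x, y⟫_ℂ = ⟪x, S y⟫_ℂ) (x y : Completion E) :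
    ⟪completionEquiv S x, y⟫_ℂ = ⟪x, completionEquiv S y⟫_ℂ := by
  induction x, y using Completion.induction_on₂ with
  | hp => apply isClosed_eq <;> fun_prop
  | ih x y => simp only [completionEquiv_coe, Completion.inner_coe, hS]

lemma closedGraph_comp_comp (T : E →ₗ[ℂ] E) :
    closedGraph (S.toLinearMap ∘ₗ T ∘ₗ S.toLinearMap) =
      sandwich (completionEquiv S) (closedGraph T) := by
  ext p
  exact mem_closedGraph_iff_of_intertwining (completionEquiv S).toHomeomorph
    (completionEquiv S).symm.toHomeomorph (completionEquiv_coe S) (completionEquiv_symm_coe S)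
    S.surjective fun x => (S.symm_apply_apply _).symm

lemma exists_bound_twistedCommutator_comp_comp {T : E →ₗ[ℂ] E} {L L' N N' : E →L[ℂ] E}
    (hN : ∀ x, S (L x) = N (S x)) (hN' : ∀ x, L' (S x) = S (N' x))
    (hT : ∃ C : ℝ, ∀ x, ‖T (N x) - N' (T x)‖ ≤ C * ‖x‖) :
    ∃ C : ℝ, ∀ x, ‖S (T (S (L x))) - L' (S (T (S x)))‖ ≤ C * ‖x‖ := by
  obtain ⟨C, hC⟩ := hT
  refine ⟨‖(S : E →L[ℂ] E)‖ * (max C 0 * ‖(S : E →L[ℂ] E)‖), fun x => ?_⟩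
  calc ‖S (T (S (L x))) - L' (S (T (S x)))‖ = ‖S (T (N (S x)) - N' (T (S x)))‖ := by
        rw [hN, hN', map_sub]
    _ ≤ ‖(S : E →L[ℂ] E)‖ * ‖T (N (S x)) - N' (T (S x))‖ := (S : E →L[ℂ] E).le_opNorm _
    _ ≤ ‖(S : E →L[ℂ] E)‖ * (max C 0 * (‖(S : E →L[ℂ] E)‖ * ‖x‖)) := by
        gcongr
        refine (hC _).trans ?_
        gcongr
        exacts [le_max_left _ _, (S : E →L[ℂ] E).le_opNorm _]
    _ = _ := by ring

end Sandwich

lemma exists_mem_closedGraph_of_bounded_twistedCommutator {L L' : E →L[ℂ] E} {C : ℝ}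
    (hC : ∀ x, ‖T (L x) - L' (T x)‖ ≤ C * ‖x‖) (hp : p ∈ closedGraph T) :
    ∃ y, (L.completion p.1, y) ∈ closedGraph T ∧ ‖y - L'.completion p.2‖ ≤ C * ‖p.1‖ := by
  let K : E →L[ℂ] E := LinearMap.mkContinuous (T ∘ₗ L.toLinearMap - L'.toLinearMap ∘ₗ T) C hC
  have hK : ∀ x, K x = T (L x) - L' (T x) := fun x => rfl
  refine ⟨L'.completion p.2 + K.completion p.1, ?_, ?_⟩
  · refine closedGraph_induction
      (P := fun p => (L.completion p.1, L'.completion p.2 + K.completion p.1) ∈ closedGraph T)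
      (isClosed_closedGraph.preimage
        (f := fun p : _ × _ => (L.completion p.1, L'.completion p.2 + K.completion p.1))
        (by fun_prop)) (fun x => ?_) hp
    simp only [ContinuousLinearMap.completion_apply_coe]
    rw [← Completion.coe_add, hK, add_sub_cancel]
    exact coe_mem_closedGraph T _
  · rw [add_sub_cancel_left]
    generalize p.1 = x
    induction x using Completion.induction_on with
    | hp => exact isClosed_le (by fun_prop) (by fun_prop)
    | ih x =>
      rw [ContinuousLinearMap.completion_apply_coe, Completion.norm_coe, Completion.norm_coe]
      exact hC x

end ClosedGraph

end ModularTriple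

namespace TwistedTriple

open ModularTriple

variable {A : Type*} [Ring A] [StarRing A] [Algebra ℂ A]

lemma isIsomorphic_transpose_of_conjugateLinear {H H' : Type*}
    [NormedAddCommGroup H] [InnerProductSpace ℂ H] [CompleteSpace H]
    [NormedAddCommGroup H'] [InnerProductSpace ℂ H'] [CompleteSpace H']
    {t : TwistedTriple A H} {t' : TwistedTriple Aᵐᵒᵖ H'} {G : Submodule ℂ (H' × H')}
    (h_dense : Dense (G.map (LinearMap.fst ℂ _ _) : Set H')) (hG : G.adjoint = G)
    (h_dirac : t'.dirac = G.toLinearPMap) (J : H ≃ₗᵢ⋆[ℂ] H')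
    (h_twist : ∀ a, MulOpposite.op (t.twist a) = t'.twist.symm (MulOpposite.op a))
    (h_rep : ∀ a x, J (t.rep a x) = t'.rep (MulOpposite.op (star a)) (J x))
    (h_graph : ∀ x y, (x, y) ∈ t.dirac.graph ↔ (J x, J y) ∈ G) :
    t.IsIsomorphic t'.transpose (opOpStar A) := by
  refine ⟨fun a => congrArg MulOpposite.op (h_twist a),
    J.trans (InnerProductSpace.toDual ℂ H'), fun a x => ?_, fun x y => ?_⟩
  · refine (InnerProductSpace.toDual ℂ H').symm.injective ?_
    have h_transpose := toDual_symm_transpose (t'.rep (MulOpposite.op a))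
      (InnerProductSpace.toDual ℂ H' (J x))
    rw [LinearIsometryEquiv.symm_apply_apply, ← ContinuousLinearMap.star_eq_adjoint,
      ← map_star] at h_transpose
    exact ((LinearIsometryEquiv.symm_apply_apply _ _).trans (h_rep a x)).trans h_transpose.symm
  · rw [h_graph]
    change _ ↔ _ ∈ (transposePMap t'.dirac).graph
    rw [h_dirac, mem_graph_transposePMap_iff h_dense hG]
    simp

variable {E : Type*} [SeminormedAddCommGroup E] [InnerProductSpace ℂ E]
  {t : TwistedTriple A (Completion E)} {T : E →ₗ[ℂ] E}

lemma isModularSpectralTriple_of_dirac_eq_closedGraph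
    (h_dirac : t.dirac = (closedGraph T).toLinearPMap)
    (h_twist : ∀ a, t.twist (star a) = star (t.twist.symm a))
    (h_adjoint : (closedGraph T).adjoint = closedGraph T)
    (h_compact : IsCompactOperator fun p : closedGraph T => (p : Completion E × Completion E).1)
    {π : A → E →L[ℂ] E} (h_rep : ∀ a, t.rep a = (π a).completion)
    (h_comm : ∀ a, ∃ C : ℝ, ∀ x, ‖T (π a x) - π (t.twist a) (T x)‖ ≤ C * ‖x‖) :
    t.IsModularSpectralTriple := by
  have h_dense := dense_map_fst_closedGraph T
  have h_graph : t.dirac.graph = closedGraph T := by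
    rw [h_dirac, graph_toLinearPMap h_dense h_adjoint.ge]
  have h_image : ∀ a, ∃ C : ℝ, ∀ x : t.dirac.domain, ∃ y : t.dirac.domain, y = t.rep a x ∧
      ‖t.dirac y - t.rep (t.twist a) (t.dirac x)‖ ≤ C * ‖(x : Completion E)‖ := fun a => by
    obtain ⟨C, hC⟩ := h_comm a
    refine ⟨C, fun x => ?_⟩
    obtain ⟨z, hz, hzC⟩ := exists_mem_closedGraph_of_bounded_twistedCommutator hC
      (h_graph.le (LinearPMap.mem_graph _ x))
    obtain ⟨y, hy, rfl⟩ := (LinearPMap.mem_graph_iff _).1 (h_graph.ge hz)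
    rw [h_rep, h_rep]
    exact ⟨y, hy, hzC⟩
  refine ⟨h_twist, h_dirac ▸ isSelfAdjoint_toLinearPMap h_dense h_adjoint,
    h_dirac ▸ hasCompactResolvent_toLinearPMap h_dense h_adjoint h_compact, fun a x hx => ?_,
    fun a => ?_⟩
  · obtain ⟨C, hC⟩ := h_image a
    obtain ⟨y, hy, -⟩ := hC ⟨x, hx⟩
    exact hy ▸ y.2
  · obtain ⟨C, hC⟩ := h_image a
    refine ⟨C, fun x hx => ?_⟩
    obtain ⟨y, hy, hyC⟩ := hC x
    rwa [show y = ⟨t.rep a x, hx⟩ from Subtype.ext hy] at hyC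

end TwistedTriple

namespace NCTorus

variable {θ : ℝ} {τ : UpperHalfPlane}

section Derivation

lemma differentiableAt_α (a : Smooth θ) (s : ℝ × ℝ) :
    DifferentiableAt ℝ (fun s : ℝ × ℝ => α s (a : Ambient θ)) s :=
  (contDiff_α a).differentiable (by simp) s

lemma coe_δ (e : ℝ × ℝ) (a : Smooth θ) : (δ e a : Ambient θ) =
    -Complex.I • fderiv ℝ (fun s : ℝ × ℝ => α s (a : Ambient θ)) 0 e := rfl

lemma δ_mul (e : ℝ × ℝ) (a b : Smooth θ) : δ e (a * b) = δ e a * b + a * δ e b := by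
  apply Subtype.ext
  have h_product : (fun s : ℝ × ℝ => α s ((a * b : Smooth θ) : Ambient θ)) =
      (fun s => α s (a : Ambient θ)) * fun s => α s (b : Ambient θ) :=
    funext fun s => map_mul (α s) _ _
  have h_leibniz :=
    ((differentiableAt_α a 0).hasFDerivAt.mul' (differentiableAt_α b 0).hasFDerivAt).fderiv
  change (δ e (a * b) : Ambient θ) = (δ e a : Ambient θ) * b + a * (δ e b : Ambient θ)
  rw [coe_δ, coe_δ, coe_δ, h_product, h_leibniz]
  simp only [α_zero, add_apply, smul_apply, smul_eq_mul, MulOpposite.smul_eq_mul_unop,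
    MulOpposite.unop_op, smul_add, smul_mul_assoc, mul_smul_comm]
  exact add_comm _ _

lemma δ_star (e : ℝ × ℝ) (a : Smooth θ) : δ e (star a) = -star (δ e a) := by
  apply Subtype.ext
  have h_star : (fun s : ℝ × ℝ => α s ((star a : Smooth θ) : Ambient θ)) =
      (starL' ℝ (A := Ambient θ)).toContinuousLinearMap ∘ fun s => α s (a : Ambient θ) :=
    funext fun s => map_star (α s) _
  have h_fderiv := ((starL' ℝ (A := Ambient θ)).toContinuousLinearMap.hasFDerivAt.comp (0 : ℝ × ℝ)
    (differentiableAt_α a 0).hasFDerivAt).fderiv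
  change (δ e (star a) : Ambient θ) = -star (δ e a : Ambient θ)
  rw [coe_δ, coe_δ, h_star, h_fderiv, star_smul]
  simp

lemma δ_one (e : ℝ × ℝ) : δ e (1 : Smooth θ) = 0 := by
  simpa only [mul_one, one_mul, left_eq_add] using δ_mul e (1 : Smooth θ) 1

end Derivation

section Trace

/-- The unitary `e_{m,n} ↦ e^{i(s₁m + s₂n)} e_{m,n}` of `ℓ²(ℤ²)`, which implements `α_s` in the
regular representation. -/
def gauge (s : ℝ × ℝ) : L2 ≃ₗᵢ[ℂ] L2 :=
  wshift (fun i => Circle.exp (s.1 * i.1 + s.2 * i.2)) (Equiv.refl _)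

lemma gauge_vacuum (s : ℝ × ℝ) : gauge s vacuum = vacuum := by
  refine lp.ext (funext fun i => ?_)
  by_cases hi : i = (0, 0)
  · subst hi; simp [gauge, wshift_apply, vacuum]
  · simp [gauge, wshift_apply, vacuum, hi]

lemma gauge_regU (s : ℝ × ℝ) (x : L2) :
    gauge s (regU x) = (Circle.exp s.1 : ℂ) • regU (gauge s x) := by
  refine lp.ext (funext fun ⟨m, n⟩ => ?_)
  change wshift _ _ (wshift _ _ x) _ = (Circle.exp s.1 : ℂ) * wshift _ _ (wshift _ _ x) _
  have h_phase : Circle.exp (s.1 * m + s.2 * n) =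
      Circle.exp s.1 * Circle.exp (s.1 * (m - 1 : ℤ) + s.2 * n) := by
    rw [← Circle.exp_add]
    push_cast
    ring_nf
  simp only [wshift_apply, left, Equiv.prodCongr_apply, Prod.map, Equiv.subRight_apply,
    Equiv.refl_apply, h_phase, Circle.coe_mul, Circle.coe_one]
  ring

lemma gauge_regV (s : ℝ × ℝ) (x : L2) :
    gauge s (regV θ x) = (Circle.exp s.2 : ℂ) • regV θ (gauge s x) := by
  refine lp.ext (funext fun ⟨m, n⟩ => ?_)
  change wshift _ _ (wshift _ _ x) _ = (Circle.exp s.2 : ℂ) * wshift _ _ (wshift _ _ x) _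
  have h_phase : Circle.exp (s.1 * m + s.2 * n) =
      Circle.exp s.2 * Circle.exp (s.1 * m + s.2 * (n - 1 : ℤ)) := by
    rw [← Circle.exp_add]
    push_cast
    ring_nf
  simp only [wshift_apply, down, Equiv.prodCongr_apply, Prod.map, Equiv.subRight_apply,
    Equiv.refl_apply, h_phase, Circle.coe_mul]
  ring

lemma evalReg_α (s : ℝ × ℝ) {a : Ambient θ} (ha : a ∈ A θ) :
    evalReg θ (α s a) = (gauge s).conjStarAlgEquiv (evalReg θ a) := by
  let f : Ambient θ →⋆ₐ[ℂ] (L2 →L[ℂ] L2) := (evalReg θ).comp (α s)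
  let g : Ambient θ →⋆ₐ[ℂ] (L2 →L[ℂ] L2) :=
    ((gauge s).conjStarAlgEquiv : (L2 →L[ℂ] L2) →⋆ₐ[ℂ] (L2 →L[ℂ] L2)).comp (evalReg θ)
  suffices h_le : A θ ≤ StarAlgHom.equalizer f g from h_le ha
  apply StarSubalgebra.topologicalClosure_minimal
  · refine StarAlgHom.adjoin_le_equalizer _ _ ?_
    rintro _ (rfl | rfl) <;> refine ContinuousLinearMap.ext fun x => ?_
    · have h := gauge_regU s ((gauge s).symm x)
      rw [(gauge s).apply_symm_apply] at h
      exact h.symm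
    · have h := gauge_regV (θ := θ) s ((gauge s).symm x)
      rw [(gauge s).apply_symm_apply] at h
      exact h.symm
  · have h_conj : Continuous fun L : L2 →L[ℂ] L2 =>
        (gauge s : L2 →L[ℂ] L2) ∘L L ∘L ((gauge s).symm : L2 →L[ℂ] L2) := by fun_prop
    exact isClosed_eq ((continuous_evalReg θ).comp (αCLM θ s).continuous)
      (h_conj.comp (continuous_evalReg θ))

lemma φ_α (s : ℝ × ℝ) {a : Ambient θ} (ha : a ∈ A θ) : φ (α s a) = φ a := by
  have h_symm : (gauge s).symm vacuum = vacuum := by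
    rw [LinearIsometryEquiv.symm_apply_eq, gauge_vacuum]
  calc φ (α s a) = ⟪vacuum, gauge s (evalReg θ a ((gauge s).symm vacuum))⟫_ℂ := by
        rw [φ_apply, evalReg_α s ha]; rfl
    _ = ⟪gauge s vacuum, gauge s (evalReg θ a vacuum)⟫_ℂ := by rw [h_symm, gauge_vacuum]
    _ = φ a := by rw [LinearIsometryEquiv.inner_map_map, φ_apply]

lemma tr_δ (e : ℝ × ℝ) (a : Smooth θ) : tr (δ e a) = 0 := by
  let φL : Ambient θ →L[ℝ] ℂ :=
    ({ φ (θ := θ) with cont := continuous_φ } : Ambient θ →L[ℂ] ℂ).restrictScalars ℝ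
  have h_comp := φL.hasFDerivAt.comp (0 : ℝ × ℝ) (differentiableAt_α a 0).hasFDerivAt
  have h_const : φL ∘ (fun s : ℝ × ℝ => α s (a : Ambient θ)) = fun _ => φ (a : Ambient θ) :=
    funext fun s => φ_α s a.2.1
  rw [h_const] at h_comp
  have h_zero : φ (fderiv ℝ (fun s : ℝ × ℝ => α s (a : Ambient θ)) 0 e) = 0 :=
    congrArg (fun L => L e) (h_comp.unique (hasFDerivAt_const _ _))
  change φ (δ e a : Ambient θ) = 0
  rw [coe_δ, map_smul, h_zero, smul_zero]

lemma inner_vec_δ (e : ℝ × ℝ) (a b : Smooth θ) :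
    ⟪vec (δ e a), vec b⟫_ℂ = ⟪vec a, vec (δ e b)⟫_ℂ := by
  have h := tr_δ e (star a * b)
  rw [δ_mul, δ_star, map_add, neg_mul (star (δ e a)), map_neg, tr_star_mul, tr_star_mul] at h
  linear_combination -h

end Trace

section Homogeneous

/-- `a` is an eigenvector of the action of `ℝ²`, with character `s ↦ e^{i(s₁p₁ + s₂p₂)}`. -/
def IsHomogeneous (p : ℝ × ℝ) (a : Ambient θ) : Prop :=
  ∀ s : ℝ × ℝ, α s a = (Circle.exp (s.1 * p.1 + s.2 * p.2) : ℂ) • a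

lemma isHomogeneous_genU : IsHomogeneous (1, 0) (genU θ) := fun s => by simp [α_genU]

lemma isHomogeneous_genV : IsHomogeneous (0, 1) (genV θ) := fun s => by simp [α_genV]

variable {p : ℝ × ℝ}

lemma IsHomogeneous.mem_smooth {a : Ambient θ} (h : IsHomogeneous p a) (ha : a ∈ A θ) :
    a ∈ Smooth θ := by
  refine ⟨ha, ?_⟩
  simp only [h _, Circle.coe_exp]
  have h_phase : ContDiff ℝ ∞ fun s : ℝ × ℝ => ((s.1 * p.1 + s.2 * p.2 : ℝ) : ℂ) :=
    Complex.ofRealCLM.contDiff.comp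
      ((contDiff_fst.mul contDiff_const).add (contDiff_snd.mul contDiff_const))
  exact ((h_phase.mul contDiff_const).cexp).smul contDiff_const

lemma IsHomogeneous.δ_eq {a : Smooth θ} (h : IsHomogeneous p (a : Ambient θ)) (e : ℝ × ℝ) :
    δ e a = ((e.1 * p.1 + e.2 * p.2 : ℝ) : ℂ) • a := by
  set c : ℂ := ((e.1 * p.1 + e.2 * p.2 : ℝ) : ℂ) with hc
  have h_orbit : (fun t : ℝ => α (t • e) (a : Ambient θ)) =
      fun t : ℝ => Complex.exp (t * (c * Complex.I)) • (a : Ambient θ) := by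
    funext t
    rw [h, Circle.coe_exp, hc]
    congr 2
    simp only [Prod.smul_fst, Prod.smul_snd, smul_eq_mul]
    push_cast
    ring
  have h_chain : HasDerivAt (fun t : ℝ => α (t • e) (a : Ambient θ))
      (fderiv ℝ (fun s : ℝ × ℝ => α s (a : Ambient θ)) 0 e) 0 := by
    simpa only [zero_smul, one_smul, id_eq, Function.comp_def] using
      (differentiableAt_α a ((0 : ℝ) • e)).hasFDerivAt.comp_hasDerivAt (0 : ℝ)
        ((hasDerivAt_id (0 : ℝ)).smul_const e)
  have h_exp : HasDerivAt (fun t : ℝ => Complex.exp (t * (c * Complex.I)) • (a : Ambient θ))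
      ((c * Complex.I) • (a : Ambient θ)) 0 := by
    simpa using ((Complex.ofRealCLM.hasDerivAt (x := 0)).mul_const
      (c * Complex.I)).cexp.smul_const (a : Ambient θ)
  apply Subtype.ext
  change (δ e a : Ambient θ) = c • (a : Ambient θ)
  rw [coe_δ, h_chain.unique (h_orbit ▸ h_exp), smul_smul]
  congr 1
  linear_combination -c * Complex.I_mul_I

end Homogeneous

section Monomial

lemma genU_mem_A : genU θ ∈ A θ :=
  StarSubalgebra.le_topologicalClosure _ (StarAlgebra.subset_adjoin ℂ _ (by simp))

lemma genV_mem_A : genV θ ∈ A θ :=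
  StarSubalgebra.le_topologicalClosure _ (StarAlgebra.subset_adjoin ℂ _ (by simp))

/-- `U` as a unitary of `A_θ^∞`. -/
def smoothU (θ : ℝ) : unitary (Smooth θ) where
  val := ⟨genU θ, isHomogeneous_genU.mem_smooth genU_mem_A⟩
  property := ⟨Subtype.ext (Ambient.ext fun p => p.hu.1),
    Subtype.ext (Ambient.ext fun p => p.hu.2)⟩

/-- `V` as a unitary of `A_θ^∞`. -/
def smoothV (θ : ℝ) : unitary (Smooth θ) where
  val := ⟨genV θ, isHomogeneous_genV.mem_smooth genV_mem_A⟩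
  property := ⟨Subtype.ext (Ambient.ext fun p => p.hv.1),
    Subtype.ext (Ambient.ext fun p => p.hv.2)⟩

lemma δ_zpow {u : unitary (Smooth θ)} {e : ℝ × ℝ} {r : ℝ}
    (hu : δ e (u : Smooth θ) = (r : ℂ) • (u : Smooth θ)) (n : ℤ) :
    δ e ((u ^ n : unitary (Smooth θ)) : Smooth θ) =
      ((n * r : ℝ) : ℂ) • ((u ^ n : unitary (Smooth θ)) : Smooth θ) := by
  have h_inv : δ e ((u⁻¹ : unitary (Smooth θ)) : Smooth θ) =
      -(r : ℂ) • ((u⁻¹ : unitary (Smooth θ)) : Smooth θ) := by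
    rw [← Unitary.star_eq_inv, Unitary.coe_star, δ_star, hu, star_smul, neg_smul]
    simp
  induction n using Int.induction_on with
  | zero => simp [δ_one]
  | succ n ih =>
    rw [zpow_add_one, Submonoid.coe_mul, δ_mul, ih, hu, smul_mul_assoc, mul_smul_comm, ← add_smul]
    push_cast
    ring_nf
  | pred n ih =>
    rw [zpow_sub_one, Submonoid.coe_mul, δ_mul, ih, h_inv, smul_mul_assoc, mul_smul_comm,
      ← add_smul]
    push_cast
    ring_nf

/-- `U^m V^n` for `p = (m, n)`. -/
def monomial (θ : ℝ) (p : ℤ × ℤ) : Smooth θ :=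
  (smoothU θ ^ p.1 * smoothV θ ^ p.2 : unitary (Smooth θ))

lemma δ_monomial (e : ℝ × ℝ) (p : ℤ × ℤ) :
    δ e (monomial θ p) = ((e.1 * p.1 + e.2 * p.2 : ℝ) : ℂ) • monomial θ p := by
  have hU := isHomogeneous_genU.δ_eq (a := (smoothU θ : Smooth θ)) e
  have hV := isHomogeneous_genV.δ_eq (a := (smoothV θ : Smooth θ)) e
  rw [monomial, Submonoid.coe_mul, δ_mul, δ_zpow hU, δ_zpow hV, smul_mul_assoc, mul_smul_comm,
    ← add_smul]
  push_cast
  ring_nf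

/-- The regular representation on the unitaries of `A_θ^∞`. -/
def regUnitary (θ : ℝ) : unitary (Smooth θ) →* (L2 ≃ₗᵢ[ℂ] L2) :=
  Unitary.linearIsometryEquiv.toMonoidHom.comp
    (Unitary.map (.ofClass ((evalReg θ).comp (Smooth θ).subtype))).toMonoidHom

lemma vec_unitary_mul (u : unitary (Smooth θ)) (a : Smooth θ) :
    vec ((u : Smooth θ) * a) = regUnitary θ u (vec a) := by
  change evalReg θ (((u : Smooth θ) : Ambient θ) * a) vacuum = _
  rw [map_mul]
  rfl

lemma regUnitary_smoothU : regUnitary θ (smoothU θ) = regU :=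
  LinearIsometryEquiv.ext fun _ => rfl

lemma regUnitary_smoothV : regUnitary θ (smoothV θ) = regV θ :=
  LinearIsometryEquiv.ext fun _ => rfl

lemma zpow_apply_eq_of_apply_eq_add_one {E : Type*} [SeminormedAddCommGroup E] [Module ℂ E]
    {T : E ≃ₗᵢ[ℂ] E} {f : ℤ → E} (hT : ∀ n, T (f n) = f (n + 1)) (n : ℤ) :
    (T ^ n) (f 0) = f n := by
  induction n using Int.induction_on with
  | zero => rfl
  | succ n ih =>
    rw [zpow_add_one, (Commute.self_zpow T _).symm.eq]
    exact (congrArg T ih).trans (hT _)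
  | pred n ih =>
    rw [zpow_sub_one, (Commute.self_zpow T _).inv_left.symm.eq]
    refine (congrArg T.symm ih).trans (T.symm_apply_eq.2 ?_)
    rw [hT, sub_add_cancel]

lemma regU_single (m n : ℤ) : regU (lp.single 2 (m, n) 1) = lp.single 2 (m + 1, n) 1 := by
  refine lp.ext (funext fun i => ?_)
  have h_iff : left i = (m, n) ↔ i = (m + 1, n) := by
    rw [← Equiv.eq_symm_apply]
    simp [left]
  by_cases hi : i = (m + 1, n)
  · simp only [regU, wshift_apply, h_iff.2 hi]
    simp [hi]
  · simp [regU, wshift_apply, hi, mt h_iff.1 hi]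

lemma regV_single (n : ℤ) : regV θ (lp.single 2 (0, n) 1) = lp.single 2 (0, n + 1) 1 := by
  refine lp.ext (funext fun i => ?_)
  have h_iff : down i = (0, n) ↔ i = (0, n + 1) := by
    rw [← Equiv.eq_symm_apply]
    simp [down]
  by_cases hi : i = (0, n + 1)
  · simp only [regV, wshift_apply, h_iff.2 hi]
    simp [hi]
  · simp [regV, wshift_apply, hi, mt h_iff.1 hi]

lemma vec_monomial (p : ℤ × ℤ) : vec (monomial θ p) = lp.single 2 p 1 := by
  have hV : (regV θ ^ p.2) vacuum = lp.single 2 (0, p.2) 1 :=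
    zpow_apply_eq_of_apply_eq_add_one (f := fun n => lp.single 2 (0, n) 1) regV_single p.2
  have hU : (regU ^ p.1) (lp.single 2 (0, p.2) 1) = lp.single 2 p 1 :=
    zpow_apply_eq_of_apply_eq_add_one (f := fun m => lp.single 2 (m, p.2) 1)
      (fun m => regU_single m p.2) p.1
  have h_one : vec ((smoothV θ ^ p.2 : unitary (Smooth θ)) : Smooth θ) =
      regUnitary θ (smoothV θ ^ p.2) vacuum := rfl
  rw [monomial, Submonoid.coe_mul, vec_unitary_mul, h_one, map_zpow, map_zpow,
    regUnitary_smoothU, regUnitary_smoothV, hV, hU]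

end Monomial

section Frame

lemma PreForms.add_fst (x y : PreForms θ τ) (i : Fin 2) : (x + y).1 i = x.1 i + y.1 i := rfl

lemma PreForms.add_snd (x y : PreForms θ τ) (i : Fin 2) : (x + y).2 i = x.2 i + y.2 i := rfl

lemma PreForms.smul_fst (c : ℂ) (x : PreForms θ τ) (i : Fin 2) : (c • x).1 i = c • x.1 i := rfl

lemma PreForms.smul_snd (c : ℂ) (x : PreForms θ τ) (i : Fin 2) : (c • x).2 i = c • x.2 i := rfl

lemma normSq_coe_upperHalfPlane (τ : UpperHalfPlane) :
    Complex.normSq τ = τ.re ^ 2 + τ.im ^ 2 := by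
  rw [Complex.normSq_apply, sq, sq, UpperHalfPlane.coe_re, UpperHalfPlane.coe_im]

lemma sqrt_im_ne_zero (τ : UpperHalfPlane) : (√τ.im : ℂ) ≠ 0 :=
  Complex.ofReal_ne_zero.2 (Real.sqrt_pos.2 τ.im_pos).ne'

lemma sqrt_im_sq (τ : UpperHalfPlane) : (√τ.im : ℂ) ^ 2 = τ.im := by
  rw [← Complex.ofReal_pow, Real.sq_sqrt τ.im_pos.le]

lemma inner_eq_inner_vec (x y : PreForms θ τ) : ⟪x, y⟫_ℂ =
    (τ.im : ℂ)⁻¹ * ⟪vec (x.1 0), vec (y.1 0)⟫_ℂ + τ.im * ⟪vec (x.1 1), vec (y.1 1)⟫_ℂ +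
    (τ.im : ℂ)⁻¹ * ⟪vec (x.2 0 + (τ.re : ℂ) • x.2 1), vec (y.2 0 + (τ.re : ℂ) • y.2 1)⟫_ℂ +
    τ.im * ⟪vec (x.2 1), vec (y.2 1)⟫_ℂ := by
  have h_im : (τ.im : ℂ) ≠ 0 := Complex.ofReal_ne_zero.2 τ.im_pos.ne'
  rw [inner_def]
  simp only [preInner, tr_star_mul, gInv, Fin.sum_univ_two, Matrix.of_apply, Matrix.cons_val',
    Matrix.cons_val_zero, Matrix.cons_val_one, Matrix.cons_val_fin_one,
    normSq_coe_upperHalfPlane, map_add, map_smul, inner_add_left, inner_add_right,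
    inner_smul_left, inner_smul_right, Complex.conj_ofReal]
  push_cast
  field_simp
  ring

/-- The components of a form in an orthonormal frame, two of the even and two of the odd part; on
odd forms it comes from `∑ g^{jk} a_j a_k = (a₁ + Re τ a₂)² + (Im τ a₂)²`. -/
def frame (θ : ℝ) (τ : UpperHalfPlane) : PreForms θ τ ≃ₗ[ℂ] (Fin 4 → Smooth θ) where
  toFun x := ![(√τ.im : ℂ)⁻¹ • x.1 0, (√τ.im : ℂ) • x.1 1,
    (√τ.im : ℂ)⁻¹ • (x.2 0 + (τ.re : ℂ) • x.2 1), (√τ.im : ℂ) • x.2 1]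
  invFun a := (![(√τ.im : ℂ) • a 0, (√τ.im : ℂ)⁻¹ • a 1],
    ![(√τ.im : ℂ) • a 2 - (τ.re * (√τ.im : ℂ)⁻¹) • a 3, (√τ.im : ℂ)⁻¹ • a 3])
  map_add' x y := funext fun j => by
    fin_cases j <;> simp only [PreForms.add_fst, PreForms.add_snd, Fin.zero_eta, Fin.mk_one,
      Fin.reduceFinMk, Matrix.cons_val, Pi.add_apply] <;> module
  map_smul' c x := funext fun j => by
    fin_cases j <;> simp only [PreForms.smul_fst, PreForms.smul_snd, Fin.zero_eta, Fin.mk_one,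
      Fin.reduceFinMk, Matrix.cons_val, Pi.smul_apply, RingHom.id_apply] <;> module
  left_inv x := by
    have h := sqrt_im_ne_zero τ
    refine PreForms.ext (Fin.forall_fin_two.2 ⟨?_, ?_⟩) (Fin.forall_fin_two.2 ⟨?_, ?_⟩) <;>
      simp only [Matrix.cons_val] <;> match_scalars <;> field_simp
    ring
  right_inv a := funext fun j => by
    have h := sqrt_im_ne_zero τ
    fin_cases j <;> simp only [Fin.zero_eta, Fin.mk_one, Fin.reduceFinMk, Matrix.cons_val] <;>
      match_scalars <;> field_simp
    ring

lemma frame_apply (x : PreForms θ τ) : frame θ τ x =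
    ![(√τ.im : ℂ)⁻¹ • x.1 0, (√τ.im : ℂ) • x.1 1,
      (√τ.im : ℂ)⁻¹ • (x.2 0 + (τ.re : ℂ) • x.2 1), (√τ.im : ℂ) • x.2 1] := rfl

lemma inner_eq_sum_frame (x y : PreForms θ τ) :
    ⟪x, y⟫_ℂ = ∑ j, ⟪vec (frame θ τ x j), vec (frame θ τ y j)⟫_ℂ := by
  have h := sqrt_im_ne_zero τ
  rw [inner_eq_inner_vec, Fin.sum_univ_four]
  simp only [frame_apply, Matrix.cons_val, map_smul, inner_smul_left, inner_smul_right, map_inv₀,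
    Complex.conj_ofReal, ← sqrt_im_sq]
  field_simp

lemma norm_sq_eq_sum_frame (x : PreForms θ τ) : ‖x‖ ^ 2 = ∑ j, ‖vec (frame θ τ x j)‖ ^ 2 := by
  simp only [@norm_sq_eq_re_inner ℂ, inner_eq_sum_frame, map_sum]

end Frame

section Graded

/-- The operator acting by `T₀` on the components of the even part of a form and by `T₁` on those of
the odd part. -/
def gradedMap (T₀ T₁ : Smooth θ →ₗ[ℂ] Smooth θ) : PreForms θ τ →ₗ[ℂ] PreForms θ τ :=
  LinearMap.prodMap (entrywise T₀) (entrywise T₁)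

variable (T₀ T₁ : Smooth θ →ₗ[ℂ] Smooth θ)

lemma gradedMap_fst (x : PreForms θ τ) (i : Fin 2) : (gradedMap T₀ T₁ x).1 i = T₀ (x.1 i) := rfl

lemma gradedMap_snd (x : PreForms θ τ) (i : Fin 2) : (gradedMap T₀ T₁ x).2 i = T₁ (x.2 i) := rfl

lemma frame_gradedMap (x : PreForms θ τ) (j : Fin 4) :
    frame θ τ (gradedMap T₀ T₁ x) j = ![T₀, T₀, T₁, T₁] j (frame θ τ x j) := by
  fin_cases j <;> simp [frame_apply, gradedMap_fst, gradedMap_snd]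

variable {T₀ T₁}

lemma gradedMap_isSymmetric (h₀ : ∀ a b, ⟪vec (T₀ a), vec b⟫_ℂ = ⟪vec a, vec (T₀ b)⟫_ℂ)
    (h₁ : ∀ a b, ⟪vec (T₁ a), vec b⟫_ℂ = ⟪vec a, vec (T₁ b)⟫_ℂ) :
    (gradedMap T₀ T₁ : PreForms θ τ →ₗ[ℂ] PreForms θ τ).IsSymmetric := fun x y => by
  rw [inner_eq_sum_frame, inner_eq_sum_frame]
  refine Finset.sum_congr rfl fun j _ => ?_
  rw [frame_gradedMap, frame_gradedMap]
  generalize frame θ τ x j = a, frame θ τ y j = b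
  fin_cases j
  exacts [h₀ a b, h₀ a b, h₁ a b, h₁ a b]

lemma norm_gradedMap_le {C₀ C₁ : ℝ} (h₀ : ∀ a, ‖vec (T₀ a)‖ ≤ C₀ * ‖vec a‖)
    (h₁ : ∀ a, ‖vec (T₁ a)‖ ≤ C₁ * ‖vec a‖) (x : PreForms θ τ) :
    ‖gradedMap T₀ T₁ x‖ ≤ max |C₀| |C₁| * ‖x‖ := by
  refine le_of_sq_le_sq ?_ (by positivity)
  rw [mul_pow, norm_sq_eq_sum_frame, norm_sq_eq_sum_frame, Finset.mul_sum]
  refine Finset.sum_le_sum fun j _ => ?_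
  rw [← mul_pow, frame_gradedMap]
  refine pow_le_pow_left₀ (norm_nonneg _) ?_ 2
  have h₀' : ∀ a, ‖vec (T₀ a)‖ ≤ max |C₀| |C₁| * ‖vec a‖ := fun a => (h₀ a).trans <| by
    gcongr; exact (le_abs_self _).trans (le_max_left _ _)
  have h₁' : ∀ a, ‖vec (T₁ a)‖ ≤ max |C₀| |C₁| * ‖vec a‖ := fun a => (h₁ a).trans <| by
    gcongr; exact (le_abs_self _).trans (le_max_right _ _)
  generalize frame θ τ x j = a
  fin_cases j
  exacts [h₀' a, h₀' a, h₁' a, h₁' a]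

/-- The operator exchanging even and odd forms which acts by `T` on odd and by `T'` on even ones. -/
def offDiagonal (T T' : (Fin 2 → Smooth θ) →ₗ[ℂ] (Fin 2 → Smooth θ)) :
    PreForms θ τ →ₗ[ℂ] PreForms θ τ :=
  (T ∘ₗ LinearMap.snd ℂ _ _).prod (T' ∘ₗ LinearMap.fst ℂ _ _)

end Graded

section Clifford

open Complex in
/-- Clifford multiplication by the covector `ξ`: the principal symbol of `d + d*`, obtained by
replacing `δ_j` with `ξ_j`. -/
def clifford (θ : ℝ) (τ : UpperHalfPlane) (ξ : ℝ × ℝ) : PreForms θ τ →ₗ[ℂ] PreForms θ τ :=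
  offDiagonal
    (ofBlocks
      !![(-I * (ξ.1 + τ.re * ξ.2)) • 1, (-I * (τ.re * ξ.1 + normSq τ * ξ.2)) • 1;
         (-I * ξ.2) • 1, (I * ξ.1) • 1])
    (ofBlocks
      !![(I * ξ.1) • 1, (I * (normSq τ * ξ.2 + τ.re * ξ.1)) • 1;
         (I * ξ.2) • 1, (-I * (τ.re * ξ.2 + ξ.1)) • 1])

lemma ofBlocks_apply (M : Matrix (Fin 2) (Fin 2) (Module.End ℂ (Smooth θ)))
    (x : Fin 2 → Smooth θ) (i : Fin 2) :
    ofBlocks M x i = M i 0 (x 0) + M i 1 (x 1) := by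
  simp [ofBlocks, Fin.sum_univ_two]

variable (ξ : ℝ × ℝ)

lemma clifford_fst_zero (x : PreForms θ τ) : (clifford θ τ ξ x).1 0 =
    (-Complex.I * (ξ.1 + τ.re * ξ.2)) • x.2 0 +
      (-Complex.I * (τ.re * ξ.1 + Complex.normSq τ * ξ.2)) • x.2 1 :=
  ofBlocks_apply _ _ _

lemma clifford_fst_one (x : PreForms θ τ) : (clifford θ τ ξ x).1 1 =
    (-Complex.I * ξ.2) • x.2 0 + (Complex.I * ξ.1) • x.2 1 :=
  ofBlocks_apply _ _ _

lemma clifford_snd_zero (x : PreForms θ τ) : (clifford θ τ ξ x).2 0 =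
    (Complex.I * ξ.1) • x.1 0 + (Complex.I * (Complex.normSq τ * ξ.2 + τ.re * ξ.1)) • x.1 1 :=
  ofBlocks_apply _ _ _

lemma clifford_snd_one (x : PreForms θ τ) : (clifford θ τ ξ x).2 1 =
    (Complex.I * ξ.2) • x.1 0 + (-Complex.I * (τ.re * ξ.2 + ξ.1)) • x.1 1 :=
  ofBlocks_apply _ _ _

lemma frame_clifford (x : PreForms θ τ) : frame θ τ (clifford θ τ ξ x) = Complex.I •
    ![-((ξ.1 + τ.re * ξ.2 : ℂ) • frame θ τ x 2 + (τ.im * ξ.2 : ℂ) • frame θ τ x 3),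
      (ξ.1 + τ.re * ξ.2 : ℂ) • frame θ τ x 3 - (τ.im * ξ.2 : ℂ) • frame θ τ x 2,
      (ξ.1 + τ.re * ξ.2 : ℂ) • frame θ τ x 0 + (τ.im * ξ.2 : ℂ) • frame θ τ x 1,
      (τ.im * ξ.2 : ℂ) • frame θ τ x 0 - (ξ.1 + τ.re * ξ.2 : ℂ) • frame θ τ x 1] := by
  have h_im := sqrt_im_ne_zero τ
  have h_normSq : (Complex.normSq τ : ℂ) = τ.re ^ 2 + (√τ.im : ℂ) ^ 4 := by
    rw [normSq_coe_upperHalfPlane, pow_mul (√τ.im : ℂ) 2 2, sqrt_im_sq]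
    push_cast
    rfl
  refine funext fun j => ?_
  fin_cases j <;>
  · simp only [frame_apply, clifford_fst_zero, clifford_fst_one, clifford_snd_zero,
      clifford_snd_one, Pi.smul_apply, Fin.zero_eta, Fin.mk_one, Fin.reduceFinMk,
      Matrix.cons_val, h_normSq, ← sqrt_im_sq]
    match_scalars <;> field_simp
    all_goals ring

lemma clifford_isSymmetric : (clifford θ τ ξ).IsSymmetric := fun x y => by
  simp only [inner_eq_sum_frame, frame_clifford, Fin.sum_univ_four, Pi.smul_apply,
    Matrix.cons_val, map_add, map_sub, map_neg, map_smul, inner_add_left, inner_sub_left,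
    inner_neg_left, inner_add_right, inner_sub_right, inner_neg_right, inner_smul_left,
    inner_smul_right, map_mul, Complex.conj_I, Complex.conj_ofReal]
  ring

lemma normSq_add_mul_coe : (Complex.normSq (ξ.1 + ξ.2 * τ) : ℂ) =
    (ξ.1 + τ.re * ξ.2) ^ 2 + (τ.im * ξ.2) ^ 2 := by
  norm_cast
  simp only [Complex.normSq_apply, Complex.add_re, Complex.add_im, Complex.re_ofReal_mul,
    Complex.im_ofReal_mul, Complex.ofReal_re, Complex.ofReal_im, UpperHalfPlane.coe_re,
    UpperHalfPlane.coe_im]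
  ring

lemma clifford_clifford (x : PreForms θ τ) :
    clifford θ τ ξ (clifford θ τ ξ x) = (Complex.normSq (ξ.1 + ξ.2 * τ) : ℂ) • x := by
  refine (frame θ τ).injective (funext fun j => ?_)
  rw [normSq_add_mul_coe, map_smul, Pi.smul_apply]
  fin_cases j <;>
  · simp only [frame_clifford, Pi.smul_apply, Fin.zero_eta, Fin.mk_one, Fin.reduceFinMk,
      Matrix.cons_val]
    match_scalars <;> ring_nf
    simp only [Complex.I_sq]
    ring

lemma norm_clifford (x : PreForms θ τ) : ‖clifford θ τ ξ x‖ = ‖(ξ.1 + ξ.2 * τ : ℂ)‖ * ‖x‖ := by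
  refine (sq_eq_sq₀ (norm_nonneg _) (by positivity)).1 ?_
  rw [@norm_sq_eq_re_inner ℂ, clifford_isSymmetric, clifford_clifford, inner_smul_right,
    mul_pow, @norm_sq_eq_re_inner ℂ _ _ _ _ x, ← Complex.normSq_eq_norm_sq]
  exact Complex.re_ofReal_mul _ _

lemma clifford_gradedMap (T₀ T₁ : Smooth θ →ₗ[ℂ] Smooth θ) (x : PreForms θ τ) :
    clifford θ τ ξ (gradedMap T₀ T₁ x) = gradedMap T₁ T₀ (clifford θ τ ξ x) := by
  refine PreForms.ext (Fin.forall_fin_two.2 ⟨?_, ?_⟩) (Fin.forall_fin_two.2 ⟨?_, ?_⟩) <;>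
  simp only [gradedMap_fst, gradedMap_snd, clifford_fst_zero, clifford_fst_one,
      clifford_snd_zero, clifford_snd_one, map_add, map_smul]

end Clifford

section Dirac

/-- The unperturbed operator `d + d*` on smooth forms. -/
def diracCore (θ : ℝ) (τ : UpperHalfPlane) : PreForms θ τ →ₗ[ℂ] PreForms θ τ :=
  offDiagonal (dStar θ τ) (d θ τ)

/-- The derivation `δ e` applied to all components of a form. -/
def formδ (θ : ℝ) (τ : UpperHalfPlane) (e : ℝ × ℝ) : PreForms θ τ →ₗ[ℂ] PreForms θ τ :=
  gradedMap (δ e) (δ e)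

lemma diracCore_eq_clifford_comp_formδ (x : PreForms θ τ) : diracCore θ τ x =
    clifford θ τ (1, 0) (formδ θ τ (1, 0) x) + clifford θ τ (0, 1) (formδ θ τ (0, 1) x) := by
  refine PreForms.ext
    (Fin.forall_fin_two.2 ⟨(ofBlocks_apply _ x.2 0).trans ?_, (ofBlocks_apply _ x.2 1).trans ?_⟩)
    (Fin.forall_fin_two.2 ⟨(ofBlocks_apply _ x.1 0).trans ?_, (ofBlocks_apply _ x.1 1).trans ?_⟩)
      <;>
  · simp only [PreForms.add_fst, PreForms.add_snd, clifford_fst_zero, clifford_fst_one,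
      clifford_snd_zero, clifford_snd_one, formδ, gradedMap_fst, gradedMap_snd, Matrix.of_apply,
      Matrix.cons_val, Matrix.cons_val', LinearMap.add_apply, LinearMap.sub_apply,
      LinearMap.smul_apply, Complex.ofReal_one, Complex.ofReal_zero]
    module

lemma diracCore_isSymmetric : (diracCore θ τ).IsSymmetric := by
  have h_comp (e : ℝ × ℝ) (x y : PreForms θ τ) : ⟪clifford θ τ e (formδ θ τ e x), y⟫_ℂ =
      ⟪x, clifford θ τ e (formδ θ τ e y)⟫_ℂ := by
    rw [clifford_isSymmetric, formδ, gradedMap_isSymmetric (inner_vec_δ e) (inner_vec_δ e),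
      clifford_gradedMap]
  intro x y
  rw [diracCore_eq_clifford_comp_formδ, diracCore_eq_clifford_comp_formδ, inner_add_left,
    inner_add_right, h_comp, h_comp]

lemma diracCore_eq_clifford {p : ℝ × ℝ} {x : PreForms θ τ}
    (hx : ∀ e, formδ θ τ e x = ((e.1 * p.1 + e.2 * p.2 : ℝ) : ℂ) • x) :
    diracCore θ τ x = clifford θ τ p x := by
  rw [diracCore_eq_clifford_comp_formδ, hx, hx, map_smul, map_smul]
  refine PreForms.ext (Fin.forall_fin_two.2 ⟨?_, ?_⟩) (Fin.forall_fin_two.2 ⟨?_, ?_⟩) <;>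
  · simp only [PreForms.add_fst, PreForms.add_snd, PreForms.smul_fst, PreForms.smul_snd,
      clifford_fst_zero, clifford_fst_one, clifford_snd_zero, clifford_snd_one]
    match_scalars <;> ring

lemma diracCore_diracCore {p : ℝ × ℝ} {x : PreForms θ τ}
    (hx : ∀ e, formδ θ τ e x = ((e.1 * p.1 + e.2 * p.2 : ℝ) : ℂ) • x) :
    diracCore θ τ (diracCore θ τ x) = (Complex.normSq (p.1 + p.2 * τ) : ℂ) • x := by
  have hx' (e : ℝ × ℝ) : formδ θ τ e (clifford θ τ p x) =
      ((e.1 * p.1 + e.2 * p.2 : ℝ) : ℂ) • clifford θ τ p x := by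
    rw [formδ, ← clifford_gradedMap, ← map_smul, ← hx, formδ]
  rw [diracCore_eq_clifford hx, diracCore_eq_clifford hx', clifford_clifford]

lemma exists_bound_diracCore_commutator {T₀ T₁ : Smooth θ →ₗ[ℂ] Smooth θ}
    {T₀' T₁' : ℝ × ℝ → Smooth θ →ₗ[ℂ] Smooth θ} {C₀ C₁ : ℝ × ℝ → ℝ}
    (h₀ : ∀ e a, δ e (T₀ a) = T₀ (δ e a) + T₀' e a) (h₁ : ∀ e a, δ e (T₁ a) = T₁ (δ e a) + T₁' e a)
    (hC₀ : ∀ e a, ‖vec (T₀' e a)‖ ≤ C₀ e * ‖vec a‖)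
    (hC₁ : ∀ e a, ‖vec (T₁' e a)‖ ≤ C₁ e * ‖vec a‖) :
    ∃ C, ∀ x : PreForms θ τ,
      ‖diracCore θ τ (gradedMap T₀ T₁ x) - gradedMap T₁ T₀ (diracCore θ τ x)‖ ≤ C * ‖x‖ := by
  have h_leibniz (e : ℝ × ℝ) (x : PreForms θ τ) :
      clifford θ τ e (formδ θ τ e (gradedMap T₀ T₁ x)) =
        gradedMap T₁ T₀ (clifford θ τ e (formδ θ τ e x)) +
          clifford θ τ e (gradedMap (T₀' e) (T₁' e) x) := by
    rw [← clifford_gradedMap, ← map_add]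
    exact congrArg _ (PreForms.ext (fun _ => h₀ e _) fun _ => h₁ e _)
  have h_bound (e : ℝ × ℝ) : ∃ C, ∀ x : PreForms θ τ,
      ‖clifford θ τ e (gradedMap (T₀' e) (T₁' e) x)‖ ≤ C * ‖x‖ := by
    refine ⟨‖(e.1 + e.2 * τ : ℂ)‖ * max |C₀ e| |C₁ e|, fun x => ?_⟩
    rw [norm_clifford, mul_assoc]
    gcongr
    exact norm_gradedMap_le (hC₀ e) (hC₁ e) x
  obtain ⟨B₁, hB₁⟩ := h_bound (1, 0)
  obtain ⟨B₂, hB₂⟩ := h_bound (0, 1)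
  refine ⟨B₁ + B₂, fun x => ?_⟩
  rw [diracCore_eq_clifford_comp_formδ, diracCore_eq_clifford_comp_formδ x, map_add, h_leibniz,
    h_leibniz, add_sub_add_comm, add_sub_cancel_left, add_sub_cancel_left, add_mul]
  exact norm_add_le_of_le (hB₁ x) (hB₂ x)

end Dirac

section Basis

/-- The forms with one component `U^m V^n` in the orthonormal frame and the others zero. -/
def basisForm (θ : ℝ) (τ : UpperHalfPlane) (i : Fin 4 × (ℤ × ℤ)) : PreForms θ τ :=
  (frame θ τ).symm (Pi.single i.1 (monomial θ i.2))

lemma inner_basisForm (i : Fin 4 × (ℤ × ℤ)) (x : PreForms θ τ) :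
    ⟪basisForm θ τ i, x⟫_ℂ = vec (frame θ τ x i.1) i.2 := by
  rw [inner_eq_sum_frame, basisForm, LinearEquiv.apply_symm_apply, Finset.sum_eq_single i.1]
  · rw [Pi.single_eq_same, vec_monomial, lp.inner_single_left]
    simp
  · intro j _ hj
    rw [Pi.single_eq_of_ne hj, map_zero, inner_zero_left]
  · simp

lemma orthonormal_basisForm : Orthonormal ℂ fun i => (basisForm θ τ i : Forms θ τ) := by
  classical
  rw [orthonormal_iff_ite]
  rintro ⟨j, p⟩ ⟨j', p'⟩
  rw [Completion.inner_coe, inner_basisForm, basisForm, LinearEquiv.apply_symm_apply]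
  obtain rfl | hj := eq_or_ne j j'
  · rw [Pi.single_eq_same, vec_monomial]
    simp [Pi.single_apply]
  · rw [Pi.single_eq_of_ne hj, map_zero, if_neg fun h => hj (congrArg Prod.fst h)]
    rfl

/-- The `j`-th component in the orthonormal frame, extended to the Hilbert space of forms. -/
def frameVec (θ : ℝ) (τ : UpperHalfPlane) (j : Fin 4) : Forms θ τ →L[ℂ] L2 :=
  (LinearMap.mkContinuous (vec ∘ₗ LinearMap.proj j ∘ₗ (frame θ τ).toLinearMap) 1 fun x => by
    rw [one_mul]
    refine le_of_sq_le_sq ?_ (norm_nonneg _)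
    rw [norm_sq_eq_sum_frame]
    exact Finset.single_le_sum (f := fun j => ‖vec (frame θ τ x j)‖ ^ 2)
      (fun _ _ => sq_nonneg _) (Finset.mem_univ j)).fromCompletion

lemma frameVec_coe (j : Fin 4) (x : PreForms θ τ) :
    frameVec θ τ j (x : Forms θ τ) = vec (frame θ τ x j) :=
  ContinuousLinearMap.fromCompletion_apply_coe _ _

lemma norm_sq_eq_sum_frameVec (z : Forms θ τ) : ‖z‖ ^ 2 = ∑ j, ‖frameVec θ τ j z‖ ^ 2 := by
  induction z using Completion.induction_on with
  | hp => exact isClosed_eq (by fun_prop) (by fun_prop)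
  | ih x => simp only [Completion.norm_coe, frameVec_coe, norm_sq_eq_sum_frame]

lemma inner_basisForm_eq_frameVec (i : Fin 4 × (ℤ × ℤ)) (z : Forms θ τ) :
    ⟪(basisForm θ τ i : Forms θ τ), z⟫_ℂ = frameVec θ τ i.1 z i.2 := by
  induction z using Completion.induction_on with
  | hp =>
    refine isClosed_eq (by fun_prop) ?_
    exact (lp.evalCLM ℂ (fun _ : ℤ × ℤ => ℂ) 2 i.2).continuous.comp (frameVec θ τ i.1).continuous
  | ih x => rw [Completion.inner_coe, frameVec_coe, inner_basisForm]

lemma span_basisForm_orthogonal :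
    (Submodule.span ℂ (Set.range fun i => (basisForm θ τ i : Forms θ τ)))ᗮ = ⊥ := by
  refine (Submodule.eq_bot_iff _).2 fun z hz => ?_
  have h_frameVec (j : Fin 4) : frameVec θ τ j z = 0 := lp.ext <| funext fun p => by
    rw [← inner_basisForm_eq_frameVec (j, p)]
    exact hz _ (Submodule.subset_span ⟨(j, p), rfl⟩)
  have h_norm := norm_sq_eq_sum_frameVec z
  simpa [h_frameVec] using h_norm

/-- The Hilbert basis of the space of forms given by the monomials in the orthonormal frame. -/
def formsBasis (θ : ℝ) (τ : UpperHalfPlane) : HilbertBasis (Fin 4 × (ℤ × ℤ)) ℂ (Forms θ τ) :=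
  HilbertBasis.mkOfOrthogonalEqBot orthonormal_basisForm span_basisForm_orthogonal

lemma formsBasis_apply (i : Fin 4 × (ℤ × ℤ)) : formsBasis θ τ i = basisForm θ τ i := by
  rw [formsBasis, HilbertBasis.coe_mkOfOrthogonalEqBot]

lemma formδ_basisForm (e : ℝ × ℝ) (i : Fin 4 × (ℤ × ℤ)) : formδ θ τ e (basisForm θ τ i) =
    ((e.1 * i.2.1 + e.2 * i.2.2 : ℝ) : ℂ) • basisForm θ τ i := by
  refine (frame θ τ).injective (funext fun j => ?_)
  have h_diagonal : ![δ e, δ e, δ e, δ e] j = (δ e : Smooth θ →ₗ[ℂ] Smooth θ) := by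
    fin_cases j <;> rfl
  rw [formδ, frame_gradedMap, h_diagonal, map_smul, Pi.smul_apply, basisForm,
    LinearEquiv.apply_symm_apply]
  obtain rfl | hj := eq_or_ne j i.1
  · rw [Pi.single_eq_same, δ_monomial]
  · rw [Pi.single_eq_of_ne hj, map_zero, smul_zero]

lemma tendsto_normSq_add_mul_coe (τ : UpperHalfPlane) :
    Tendsto (fun i : Fin 4 × (ℤ × ℤ) => Complex.normSq (i.2.1 + i.2.2 * τ)) cofinite atTop := by
  let toVec : Fin 4 × (ℤ × ℤ) → (Fin 2 → ℤ) := fun i => ![i.2.2, i.2.1]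
  have h_toVec : Tendsto toVec cofinite cofinite :=
    Tendsto.cofinite_of_finite_preimage_singleton fun v =>
      (Set.finite_univ.prod (Set.finite_singleton (v 1, v 0))).subset <| by
        rintro i rfl
        exact ⟨Set.mem_univ _, rfl⟩
  have h_norm : Tendsto (fun v : Fin 2 → ℤ => ‖v‖) cofinite atTop :=
    tendsto_norm_comp_cofinite_atTop_of_isClosedEmbedding IsClosedEmbedding.id
  have h_le (v : Fin 2 → ℤ) : EisensteinSeries.r τ * ‖v‖ ≤ ‖(v 0 * τ + v 1 : ℂ)‖ := by
    obtain rfl | hv := eq_or_ne v 0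
    · simp
    · exact EisensteinSeries.r_mul_max_le τ hv
  have h_lower : Tendsto (fun i => EisensteinSeries.r τ * ‖toVec i‖) cofinite atTop :=
    (h_norm.comp h_toVec).const_mul_atTop (EisensteinSeries.r_pos τ)
  refine ((tendsto_pow_atTop two_ne_zero).comp
    (tendsto_atTop_mono (fun i => h_le (toVec i)) h_lower)).congr fun i => ?_
  rw [Function.comp_apply, ← Complex.normSq_eq_norm_sq, add_comm]
  rfl

lemma diracCore_diracCore_basisForm (i : Fin 4 × (ℤ × ℤ)) :
    diracCore θ τ (diracCore θ τ (basisForm θ τ i)) =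
      (Complex.normSq (i.2.1 + i.2.2 * τ) : ℂ) • basisForm θ τ i := by
  simpa only [Complex.ofReal_intCast] using
    diracCore_diracCore (p := ((i.2.1 : ℝ), (i.2.2 : ℝ))) fun e => formδ_basisForm e i

end Basis

open ModularTriple

section Multiplication

lemma inner_vec_mul_left {a : Smooth θ} (ha : IsSelfAdjoint a) (b c : Smooth θ) :
    ⟪vec (a * b), vec c⟫_ℂ = ⟪vec b, vec (a * c)⟫_ℂ := by
  rw [← tr_star_mul, ← tr_star_mul, star_mul, ha.star_eq, mul_assoc]

lemma inner_vec_mul_right {a : Smooth θ} (ha : IsSelfAdjoint a) (b c : Smooth θ) :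
    ⟪vec (b * a), vec c⟫_ℂ = ⟪vec b, vec (c * a)⟫_ℂ := by
  rw [← tr_star_mul, ← tr_star_mul, star_mul, ha.star_eq, mul_assoc, tr_mul_comm, mul_assoc]

/-- Left multiplication by `a` on even and by `b` on odd forms. -/
def gradedLeft (τ : UpperHalfPlane) (a b : Smooth θ) : PreForms θ τ →L[ℂ] PreForms θ τ :=
  (gradedMap (LinearMap.mulLeft ℂ a) (LinearMap.mulLeft ℂ b)).mkContinuous _
    (norm_gradedMap_le (norm_vec_mul_le a) (norm_vec_mul_le b))

/-- Right multiplication by `a` on even and by `b` on odd forms. -/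
def gradedRight (τ : UpperHalfPlane) (a b : Smooth θ) : PreForms θ τ →L[ℂ] PreForms θ τ :=
  (gradedMap (LinearMap.mulRight ℂ a) (LinearMap.mulRight ℂ b)).mkContinuous _
    (norm_gradedMap_le (norm_vec_mul_le' a) (norm_vec_mul_le' b))

variable (a b c e : Smooth θ) (x : PreForms θ τ)

lemma leftMul_eq_gradedLeft : leftMul a x = gradedLeft τ a a x := rfl

lemma rightMul_eq_gradedRight : rightMul a x = gradedRight τ a a x := rfl

lemma gradedLeft_one : gradedLeft τ (1 : Smooth θ) 1 x = x :=
  PreForms.ext (fun _ => one_mul _) fun _ => one_mul _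

lemma gradedRight_one : gradedRight τ (1 : Smooth θ) 1 x = x :=
  PreForms.ext (fun _ => mul_one _) fun _ => mul_one _

lemma gradedLeft_gradedLeft :
    gradedLeft τ a b (gradedLeft τ c e x) = gradedLeft τ (a * c) (b * e) x :=
  PreForms.ext (fun _ => (mul_assoc _ _ _).symm) fun _ => (mul_assoc _ _ _).symm

lemma gradedRight_gradedRight :
    gradedRight τ a b (gradedRight τ c e x) = gradedRight τ (c * a) (e * b) x :=
  PreForms.ext (fun _ => mul_assoc _ _ _) fun _ => mul_assoc _ _ _

/-- `gradedLeft` as an invertible operator, for units. -/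
def gradedLeftEquiv (τ : UpperHalfPlane) (k l : (Smooth θ)ˣ) : PreForms θ τ ≃L[ℂ] PreForms θ τ :=
  .equivOfInverse (gradedLeft τ k l) (gradedLeft τ ↑k⁻¹ ↑l⁻¹)
    (fun x => by rw [gradedLeft_gradedLeft, k.inv_mul, l.inv_mul, gradedLeft_one])
    (fun x => by rw [gradedLeft_gradedLeft, k.mul_inv, l.mul_inv, gradedLeft_one])

/-- `gradedRight` as an invertible operator, for units. -/
def gradedRightEquiv (τ : UpperHalfPlane) (k l : (Smooth θ)ˣ) : PreForms θ τ ≃L[ℂ] PreForms θ τ :=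
  .equivOfInverse (gradedRight τ k l) (gradedRight τ ↑k⁻¹ ↑l⁻¹)
    (fun x => by rw [gradedRight_gradedRight, k.mul_inv, l.mul_inv, gradedRight_one])
    (fun x => by rw [gradedRight_gradedRight, k.inv_mul, l.inv_mul, gradedRight_one])

lemma gradedLeftEquiv_apply (k l : (Smooth θ)ˣ) : gradedLeftEquiv τ k l x = gradedLeft τ k l x :=
  rfl

lemma gradedRightEquiv_apply (k l : (Smooth θ)ˣ) :
    gradedRightEquiv τ k l x = gradedRight τ k l x := rfl

variable {a b}

lemma inner_gradedLeft_left (ha : IsSelfAdjoint a) (hb : IsSelfAdjoint b) (x y : PreForms θ τ) :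
    ⟪gradedLeft τ a b x, y⟫_ℂ = ⟪x, gradedLeft τ a b y⟫_ℂ :=
  gradedMap_isSymmetric (T₀ := LinearMap.mulLeft ℂ a) (T₁ := LinearMap.mulLeft ℂ b)
    (inner_vec_mul_left ha) (inner_vec_mul_left hb) x y

lemma inner_gradedRight_left (ha : IsSelfAdjoint a) (hb : IsSelfAdjoint b) (x y : PreForms θ τ) :
    ⟪gradedRight τ a b x, y⟫_ℂ = ⟪x, gradedRight τ a b y⟫_ℂ :=
  gradedMap_isSymmetric (T₀ := LinearMap.mulRight ℂ a) (T₁ := LinearMap.mulRight ℂ b)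
    (inner_vec_mul_right ha) (inner_vec_mul_right hb) x y

variable (a b)

lemma exists_bound_diracCore_gradedLeft_commutator : ∃ C, ∀ x : PreForms θ τ,
    ‖diracCore θ τ (gradedLeft τ a b x) - gradedLeft τ b a (diracCore θ τ x)‖ ≤ C * ‖x‖ :=
  exists_bound_diracCore_commutator
    (T₀' := fun e => LinearMap.mulLeft ℂ (δ e a)) (T₁' := fun e => LinearMap.mulLeft ℂ (δ e b))
    (fun e c => (δ_mul e a c).trans (add_comm _ _)) (fun e c => (δ_mul e b c).trans (add_comm _ _))
    (fun e => norm_vec_mul_le (δ e a)) (fun e => norm_vec_mul_le (δ e b))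

lemma exists_bound_diracCore_gradedRight_commutator : ∃ C, ∀ x : PreForms θ τ,
    ‖diracCore θ τ (gradedRight τ a b x) - gradedRight τ b a (diracCore θ τ x)‖ ≤ C * ‖x‖ :=
  exists_bound_diracCore_commutator
    (T₀' := fun e => LinearMap.mulRight ℂ (δ e a)) (T₁' := fun e => LinearMap.mulRight ℂ (δ e b))
    (fun e c => δ_mul e c a) (fun e c => δ_mul e c b)
    (fun e => norm_vec_mul_le' (δ e a)) (fun e => norm_vec_mul_le' (δ e b))

end Multiplication

section Triples

lemma adjoint_closedGraph_diracCore :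
    (closedGraph (diracCore θ τ)).adjoint = closedGraph (diracCore θ τ) :=
  adjoint_closedGraph diracCore_isSymmetric formsBasis_apply diracCore_diracCore_basisForm
    fun _ => Complex.normSq_nonneg _

lemma isCompactOperator_fst_closedGraph_diracCore :
    IsCompactOperator fun p : closedGraph (diracCore θ τ) => (p : Forms θ τ × Forms θ τ).1 :=
  isCompactOperator_fst_closedGraph diracCore_isSymmetric formsBasis_apply
    diracCore_diracCore_basisForm (fun _ => Complex.normSq_nonneg _) (tendsto_normSq_add_mul_coe τ)

lemma conj_star {A : Type*} [Ring A] [StarRing A] [Algebra ℂ A] {k : Aˣ} (hk : IsSelfAdjoint k)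
    (a : A) : conj k (star a) = star ((conj k).symm a) := by
  change k * star a * ↑k⁻¹ = star (↑k⁻¹ * a * k)
  rw [star_mul, star_mul, ← Units.coe_star, ← Units.coe_star, hk.star_eq, hk.inv.star_eq,
    mul_assoc]

variable (τ) (k : (Smooth θ)ˣ)

/-- The operator with matrix `(0, d* k; k d, 0)` on smooth forms, `k` acting by left
multiplication. -/
def leftDirac : PreForms θ τ →ₗ[ℂ] PreForms θ τ :=
  (gradedLeftEquiv τ 1 k).toLinearMap ∘ₗ diracCore θ τ ∘ₗ (gradedLeftEquiv τ 1 k).toLinearMap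

/-- The operator with matrix `(0, R_k d*; d R_k, 0)` on smooth forms, `R_k` being right
multiplication by `k`. -/
def rightDirac : PreForms θ τ →ₗ[ℂ] PreForms θ τ :=
  (gradedRightEquiv τ k 1).toLinearMap ∘ₗ diracCore θ τ ∘ₗ (gradedRightEquiv τ k 1).toLinearMap

/-- The triple of `A_θ^∞` acting by left multiplication, perturbed by a unit `k` in place of a Weyl
factor. -/
def leftTriple : TwistedTriple (Smooth θ) (Forms θ τ) where
  rep := leftRep θ τ
  dirac := closedOp (leftDirac τ k)
  twist := conj k

/-- The triple of the opposite algebra of `A_θ^∞` acting by right multiplication, perturbed by a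
unit `k` in place of a Weyl factor. -/
def rightTriple : TwistedTriple (Smooth θ)ᵐᵒᵖ (Forms θ τ) where
  rep := rightRep θ τ
  dirac := closedOp (rightDirac τ k)
  twist := AlgEquiv.op (conj k⁻¹)

lemma exists_bound_leftDirac_twistedCommutator (a : Smooth θ) : ∃ C : ℝ, ∀ x : PreForms θ τ,
    ‖leftDirac τ k (leftMul a x) - leftMul (conj k a) (leftDirac τ k x)‖ ≤ C * ‖x‖ := by
  have h_conj : conj k a * k = k * a := Units.inv_mul_cancel_right _ _
  refine exists_bound_twistedCommutator_comp_comp (gradedLeftEquiv τ 1 k) (T := diracCore θ τ)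
    (L := leftMul a) (L' := leftMul (conj k a)) (N := gradedLeft τ a (conj k a))
    (N' := gradedLeft τ (conj k a) a) (fun x => ?_) (fun x => ?_)
    (exists_bound_diracCore_gradedLeft_commutator _ _)
  all_goals simp only [gradedLeftEquiv_apply, leftMul_eq_gradedLeft, gradedLeft_gradedLeft,
    Units.val_one, one_mul, mul_one, h_conj]

lemma exists_bound_rightDirac_twistedCommutator (a : Smooth θ) : ∃ C : ℝ, ∀ x : PreForms θ τ,
    ‖rightDirac τ k (rightMul a x) - rightMul (conj k⁻¹ a) (rightDirac τ k x)‖ ≤ C * ‖x‖ := by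
  have h_conj : k * conj k⁻¹ a = a * k := by
    change k * (↑k⁻¹ * a * k) = a * k
    rw [mul_assoc, Units.mul_inv_cancel_left]
  refine exists_bound_twistedCommutator_comp_comp (gradedRightEquiv τ k 1) (T := diracCore θ τ)
    (L := rightMul a) (L' := rightMul (conj k⁻¹ a)) (N := gradedRight τ (conj k⁻¹ a) a)
    (N' := gradedRight τ a (conj k⁻¹ a)) (fun x => ?_) (fun x => ?_)
    (exists_bound_diracCore_gradedRight_commutator _ _)
  all_goals simp only [gradedRightEquiv_apply, rightMul_eq_gradedRight, gradedRight_gradedRight,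
    Units.val_one, one_mul, mul_one, h_conj]

end Triples

open MulOpposite

section Modular

lemma adjoint_closedGraph_leftDirac {k : (Smooth θ)ˣ} (hk : IsSelfAdjoint (k : Smooth θ)) :
    (closedGraph (leftDirac τ k)).adjoint = closedGraph (leftDirac τ k) := by
  rw [leftDirac, closedGraph_comp_comp]
  exact adjoint_sandwich _ (inner_completionEquiv_left _ (inner_gradedLeft_left (.one _) hk))
    adjoint_closedGraph_diracCore

lemma adjoint_closedGraph_rightDirac {k : (Smooth θ)ˣ} (hk : IsSelfAdjoint (k : Smooth θ)) :
    (closedGraph (rightDirac τ k)).adjoint = closedGraph (rightDirac τ k) := by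
  rw [rightDirac, closedGraph_comp_comp]
  exact adjoint_sandwich _ (inner_completionEquiv_left _ (inner_gradedRight_left hk (.one _)))
    adjoint_closedGraph_diracCore

lemma isCompactOperator_fst_closedGraph_leftDirac (k : (Smooth θ)ˣ) :
    IsCompactOperator fun p : closedGraph (leftDirac τ k) => (p : Forms θ τ × Forms θ τ).1 := by
  rw [leftDirac, closedGraph_comp_comp]
  exact isCompactOperator_fst_sandwich _ isCompactOperator_fst_closedGraph_diracCore

lemma isCompactOperator_fst_closedGraph_rightDirac (k : (Smooth θ)ˣ) :
    IsCompactOperator fun p : closedGraph (rightDirac τ k) => (p : Forms θ τ × Forms θ τ).1 := by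
  rw [rightDirac, closedGraph_comp_comp]
  exact isCompactOperator_fst_sandwich _ isCompactOperator_fst_closedGraph_diracCore

variable {k : (Smooth θ)ˣ} (hk : IsSelfAdjoint k)

include hk

theorem leftTriple_isModularSpectralTriple : (leftTriple τ k).IsModularSpectralTriple :=
  TwistedTriple.isModularSpectralTriple_of_dirac_eq_closedGraph rfl (conj_star hk)
    (adjoint_closedGraph_leftDirac (congrArg Units.val hk))
    (isCompactOperator_fst_closedGraph_leftDirac k) (π := leftMul) (fun _ => rfl)
    (exists_bound_leftDirac_twistedCommutator τ k)

theorem rightTriple_isModularSpectralTriple : (rightTriple τ k).IsModularSpectralTriple :=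
  TwistedTriple.isModularSpectralTriple_of_dirac_eq_closedGraph rfl
    (fun a => congrArg op (conj_star hk.inv a.unop))
    (adjoint_closedGraph_rightDirac (congrArg Units.val hk))
    (isCompactOperator_fst_closedGraph_rightDirac k) (π := fun a => rightMul a.unop)
    (fun _ => rfl) (fun a => exists_bound_rightDirac_twistedCommutator τ k a.unop)

end Modular

section StarSwap

/-- The conjugate-linear isometry of smooth forms which exchanges even and odd forms and takes
adjoints of the components in the orthonormal frame. -/
def starSwap (θ : ℝ) (τ : UpperHalfPlane) : PreForms θ τ ≃ₗ⋆[ℂ] PreForms θ τ where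
  toFun x := (frame θ τ).symm ![star (frame θ τ x 2), star (frame θ τ x 3),
    -star (frame θ τ x 0), -star (frame θ τ x 1)]
  invFun x := (frame θ τ).symm ![-star (frame θ τ x 2), -star (frame θ τ x 3),
    star (frame θ τ x 0), star (frame θ τ x 1)]
  map_add' x y := by
    rw [← map_add]
    congr 1
    simp [add_comm]
  map_smul' c x := by
    rw [← map_smul]
    congr 1
    simp
  left_inv x := (frame θ τ).injective <| funext fun j => by fin_cases j <;> simp
  right_inv x := (frame θ τ).injective <| funext fun j => by fin_cases j <;> simp

lemma frame_starSwap (x : PreForms θ τ) : frame θ τ (starSwap θ τ x) =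
    ![star (frame θ τ x 2), star (frame θ τ x 3), -star (frame θ τ x 0), -star (frame θ τ x 1)] :=
  (frame θ τ).apply_symm_apply _

lemma norm_starSwap (x : PreForms θ τ) : ‖starSwap θ τ x‖ = ‖x‖ := by
  refine (sq_eq_sq₀ (norm_nonneg _) (norm_nonneg _)).1 ?_
  rw [norm_sq_eq_sum_frame, norm_sq_eq_sum_frame, frame_starSwap]
  simp only [Fin.sum_univ_four, Matrix.cons_val, map_neg, norm_neg, norm_vec_star]
  ring

lemma starSwap_gradedMap {T₀ T₁ T₀' T₁' : Smooth θ →ₗ[ℂ] Smooth θ}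
    (h₀ : ∀ a, star (T₀ a) = T₀' (star a)) (h₁ : ∀ a, star (T₁ a) = T₁' (star a))
    (x : PreForms θ τ) :
    starSwap θ τ (gradedMap T₀ T₁ x) = gradedMap T₁' T₀' (starSwap θ τ x) := by
  refine (frame θ τ).injective (funext fun j => ?_)
  rw [frame_gradedMap, frame_starSwap, frame_starSwap]
  fin_cases j <;> simp [frame_gradedMap, h₀, h₁]

lemma starSwap_gradedLeft (a b : Smooth θ) (x : PreForms θ τ) :
    starSwap θ τ (gradedLeft τ a b x) = gradedRight τ (star b) (star a) (starSwap θ τ x) :=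
  starSwap_gradedMap (T₀ := LinearMap.mulLeft ℂ a) (T₁ := LinearMap.mulLeft ℂ b)
    (T₀' := LinearMap.mulRight ℂ (star a)) (T₁' := LinearMap.mulRight ℂ (star b))
    (star_mul a) (star_mul b) x

lemma starSwap_formδ (e : ℝ × ℝ) (x : PreForms θ τ) :
    starSwap θ τ (formδ θ τ e x) = -formδ θ τ e (starSwap θ τ x) :=
  starSwap_gradedMap (T₀' := -δ e) (T₁' := -δ e) (fun a => by simp [δ_star])
    (fun a => by simp [δ_star]) x

lemma starSwap_clifford (ξ : ℝ × ℝ) (x : PreForms θ τ) :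
    starSwap θ τ (clifford θ τ ξ x) = -clifford θ τ ξ (starSwap θ τ x) := by
  refine (frame θ τ).injective (funext fun j => ?_)
  rw [map_neg, Pi.neg_apply, frame_starSwap, frame_clifford, frame_clifford, frame_starSwap]
  fin_cases j <;>
  · simp only [Fin.zero_eta, Fin.mk_one, Fin.reduceFinMk, Pi.smul_apply, Matrix.cons_val,
      star_add, star_sub, star_neg, star_smul, star_mul', RCLike.star_def, Complex.conj_I,
      Complex.conj_ofReal]
    module

lemma starSwap_diracCore (x : PreForms θ τ) :
    starSwap θ τ (diracCore θ τ x) = diracCore θ τ (starSwap θ τ x) := by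
  simp only [diracCore_eq_clifford_comp_formδ, map_add, starSwap_clifford, starSwap_formδ, map_neg,
    neg_neg]

lemma starSwap_leftDirac {k : (Smooth θ)ˣ} (hk : IsSelfAdjoint (k : Smooth θ))
    (x : PreForms θ τ) :
    starSwap θ τ (leftDirac τ k x) = rightDirac τ k (starSwap θ τ x) := by
  have h_equiv (y : PreForms θ τ) : starSwap θ τ (gradedLeftEquiv τ 1 k y) =
      gradedRightEquiv τ k 1 (starSwap θ τ y) := by
    rw [gradedLeftEquiv_apply, gradedRightEquiv_apply, starSwap_gradedLeft, hk.star_eq,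
      Units.val_one, star_one]
  refine (h_equiv _).trans (congrArg _ ?_)
  exact (starSwap_diracCore _).trans (congrArg _ (h_equiv x))

/-- The extension of `starSwap` to the Hilbert space of forms. -/
def starSwapIsometry (θ : ℝ) (τ : UpperHalfPlane) : Forms θ τ ≃ₗᵢ⋆[ℂ] Forms θ τ :=
  (starSwap θ τ).extendOfIsometry (Completion.toComplₗᵢ (𝕜 := ℂ)).toLinearMap
    (Completion.toComplₗᵢ (𝕜 := ℂ)).toLinearMap Completion.denseRange_coe Completion.denseRange_coe
    fun x => by simp [norm_starSwap]

lemma starSwapIsometry_coe (x : PreForms θ τ) :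
    starSwapIsometry θ τ (x : Forms θ τ) = starSwap θ τ x :=
  LinearEquiv.extendOfIsometry_eq _ _ _ _ _ _ x

lemma starSwapIsometry_leftRep (a : Smooth θ) (z : Forms θ τ) :
    starSwapIsometry θ τ (leftRep θ τ a z) =
      rightRep θ τ (op (star a)) (starSwapIsometry θ τ z) := by
  change starSwapIsometry θ τ ((leftMul a).completion z) =
    (rightMul (star a)).completion (starSwapIsometry θ τ z)
  induction z using Completion.induction_on with
  | hp => apply isClosed_eq <;> fun_prop
  | ih x =>
    simp only [starSwapIsometry_coe, ContinuousLinearMap.completion_apply_coe]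
    exact congrArg _ (starSwap_gradedLeft a a x)

theorem leftTriple_isIsomorphic_transpose_rightTriple {k : (Smooth θ)ˣ} (hk : IsSelfAdjoint k) :
    (leftTriple τ k).IsIsomorphic (rightTriple τ k).transpose (opOpStar (Smooth θ)) := by
  have hk' : IsSelfAdjoint (k : Smooth θ) := congrArg Units.val hk
  have h_graph : (leftTriple τ k).dirac.graph = closedGraph (leftDirac τ k) :=
    graph_toLinearPMap (dense_map_fst_closedGraph _) (adjoint_closedGraph_leftDirac hk').ge
  let e := (starSwapIsometry θ τ).toHomeomorph
  refine TwistedTriple.isIsomorphic_transpose_of_conjugateLinear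
    (dense_map_fst_closedGraph (rightDirac τ k)) (adjoint_closedGraph_rightDirac hk') rfl
    (starSwapIsometry θ τ) (fun _ => rfl) starSwapIsometry_leftRep fun x y => ?_
  rw [h_graph]
  exact mem_closedGraph_iff_of_intertwining e e starSwapIsometry_coe starSwapIsometry_coe
    (starSwap θ τ).surjective fun x => (starSwap_leftDirac hk' x).symm

end StarSwap

section Weyl

lemma isSelfAdjoint_weyl {h : Smooth θ} (hh : IsSelfAdjoint h) : IsSelfAdjoint (weyl h) := by
  let _ : NormedAlgebra ℚ (Ambient θ) := NormedAlgebra.restrictScalars ℚ ℂ _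
  have h_half : star ((1 / 2 : ℂ) • h) = (1 / 2 : ℂ) • h := by
    rw [star_smul, hh.star_eq]
    simp
  refine Units.ext (Subtype.ext ?_)
  change star (NormedSpace.exp (((1 / 2 : ℂ) • h : Smooth θ) : Ambient θ)) =
    NormedSpace.exp (((1 / 2 : ℂ) • h : Smooth θ) : Ambient θ)
  rw [NormedSpace.star_exp]
  exact congrArg (fun a : Smooth θ => NormedSpace.exp (a : Ambient θ)) h_half

variable (h : Smooth θ)

lemma rightDirac_weyl : rightDirac τ (weyl h) = DTildeCore h := by
  refine LinearMap.ext fun x => ?_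
  have h_one (y : Fin 2 → Smooth θ) :
      entrywise (LinearMap.mulRight ℂ ((1 : (Smooth θ)ˣ) : Smooth θ)) y = y :=
    funext fun _ => mul_one _
  exact Prod.ext (congrArg (fun y => entrywise (LinearMap.mulRight ℂ (weyl h : Smooth θ))
    (dStar θ τ y)) (h_one x.2)) (h_one _)

lemma leftDirac_weyl : leftDirac τ (weyl h) = DBarCore h := by
  refine LinearMap.ext fun x => ?_
  have h_one (y : Fin 2 → Smooth θ) :
      entrywise (LinearMap.mulLeft ℂ ((1 : (Smooth θ)ˣ) : Smooth θ)) y = y :=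
    funext fun _ => one_mul _
  exact Prod.ext (h_one _) (congrArg (fun y => entrywise (LinearMap.mulLeft ℂ (weyl h : Smooth θ))
    (d θ τ y)) (h_one x.1))

lemma rightTriple_weyl : rightTriple τ (weyl h) = tildeTriple θ τ h := by
  rw [rightTriple, tildeTriple, rightDirac_weyl]

lemma leftTriple_weyl : leftTriple τ (weyl h) = barTriple θ τ h := by
  rw [leftTriple, barTriple, leftDirac_weyl]

end Weyl

end NCTorus

end

theorem mainTheorem3_general (θ : ℝ) (τ : UpperHalfPlane) {k : (NCTorus.Smooth θ)ˣ}
    (hk : IsSelfAdjoint k) :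
    (NCTorus.rightTriple τ k).IsModularSpectralTriple ∧
    (NCTorus.leftTriple τ k).IsModularSpectralTriple ∧
    (NCTorus.leftTriple τ k).IsIsomorphic (NCTorus.rightTriple τ k).transpose
      (opOpStar (NCTorus.Smooth θ)) :=
  ⟨NCTorus.rightTriple_isModularSpectralTriple hk, NCTorus.leftTriple_isModularSpectralTriple hk,
    NCTorus.leftTriple_isIsomorphic_transpose_rightTriple hk⟩

theorem mainTheorem3 (θ : ℝ) (τ : UpperHalfPlane) (h : NCTorus.Smooth θ)
    (hh : IsSelfAdjoint h) :
    (NCTorus.tildeTriple θ τ h).IsModularSpectralTriple ∧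
    (NCTorus.barTriple θ τ h).IsModularSpectralTriple ∧
    (NCTorus.barTriple θ τ h).IsIsomorphic (NCTorus.tildeTriple θ τ h).transpose
      (opOpStar (NCTorus.Smooth θ)) := by
  rw [← NCTorus.rightTriple_weyl, ← NCTorus.leftTriple_weyl]
  exact mainTheorem3_general θ τ (NCTorus.isSelfAdjoint_weyl hh)
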